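/- Let $R=\mathbb{Z}_3[t,t_1,t_2,t_3,t_4,t_5]$ (the cohomology ring $H^*(BT;\mathbb{Z}_3)$ of the classifying space of a maximal torus $T$ of the exceptional Lie group $E_6$), where $\mathbb{Z}_3$ is the field with three elements and $t,t_1,\dots,t_5$ all have degree $2$. Let $p_k$ be the $k$-th elementary symmetric polynomial in $t_1^2,\dots,t_5^2$ and put $c_5=t_1t_2t_3t_4t_5$. Define elements of $R$ (indices are degrees) by $$x_4=p_1,\qquad x_8=p_2-p_1^2,\qquad y_{10}=c_5-tx_8-t^3x_4,$$ $$h_{12}=p_3+ty_{10}-t^2x_8-t^4x_4,\qquad h_{16}=p_4+t^3y_{10}-t^4x_8-t^6x_4,$$ $$h_{18}=t(h_{16}-x_8^2)+t^3(-h_{12}+x_4x_8)+t^5x_8-t^7x_4+t^9,$$ $$x_{20}=h_{12}x_8+h_{16}x_4,\qquad y_{22}=h_{12}y_{10}-h_{18}x_4,\qquad y_{26}=h_{16}y_{10}+h_{18}x_8,$$ $$\begin{aligned}g_{24}={}&-t^8x_8+t^7y_{10}-t^6x_4^3+t^6x_4x_8+t^4x_4^2x_8-t^4x_8^2+t^3h_{18}+t^3x_4^2y_{10}\\&-t^3x_8y_{10}+t^2x_{20}-t^2y_{10}^2-ty_{22}-tx_4x_8y_{10},\end{aligned}$$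 $$x_{36}=-g_{24}x_4^3+h_{12}^3-h_{12}^2x_4x_8-h_{12}x_{20}x_4+h_{12}x_4^2x_8^2,$$ $$x_{48}=(-x_{36}x_8^3+x_{20}^3+x_{20}^2x_4x_8^2+x_{20}x_4^2x_8^4)/x_4^3,$$ $$x_{54}=(x_{36}y_{10}^3-y_{22}^3+x_{20}y_{22}x_4y_{10}^2+y_{22}^2x_4x_8y_{10}-y_{22}x_4^2x_8^2y_{10}^2)/x_4^3,$$ $$y_{58}=(x_{36}x_8^2y_{10}-x_{20}^2y_{22})/x_4,\qquad y_{60}=(x_{36}x_8y_{10}^2-x_{20}y_{22}^2)/x_4,$$ $$y_{64}=(y_{58}y_{10}-x_{20}y_{22}y_{26}-y_{22}^2x_8^3)/x_4,\qquad y_{76}=(y_{58}y_{22}+y_{60}x_{20}+x_{20}y_{22}^2x_8^2)/x_4;$$ all these divisions are exact in $R$. Let $A\subset R$ be the $\mathbb{Z}_3$-subalgebra generated by the thirteen elements $x_4,x_8,y_{10},x_{20},y_{22},y_{26},x_{36},x_{48},x_{54},y_{58},y_{60},y_{64},y_{76}$. Let $C$ be the formal direct sum $$C=\mathbb{Z}_3[x_4,x_8,y_{10}]\{1,x_{20},x_{20}^2,y_{22},y_{22}^2,x_{20}y_{22},y_{58},y_{60},y_{76}\}\oplus\mathbb{Z}_3[x_8,y_{10}]\{y_{26},y_{26}^2,x_{20}y_{26},y_{22}y_{26},y_{64}\}$$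 of a free module over a polynomial ring in three variables on a basis of nine symbols and a free module over a polynomial ring in two variables on a basis of five symbols. Let $\sigma:C\otimes_{\mathbb{Z}_3}\mathbb{Z}_3[x_{36},x_{48},x_{54}]\to A$ (the right factor being a formal polynomial ring in three variables) be the $\mathbb{Z}_3$-linear map with $\sigma(x^I\gamma\otimes y^J)=x^Iy^J\gamma$ for every basis symbol $\gamma$, every monomial $x^I$ of its coefficient ring and every monomial $y^J$ in $x_{36},x_{48},x_{54}$, the right-hand side being computed in $A$. Then $\sigma$ is an isomorphism of $\mathbb{Z}_3$-vector spaces. Hence $A$, which is a graded subalgebra of $R$ with finite-dimensional homogeneous parts $A_n$, has the Poincaré series $$\sum_{n\ge0}\dim_{\mathbb{Z}_3}(A_n)\,t^n=\frac{g(t)}{(1-t^4)(1-t^8)(1-t^{10})(1-t^{36})(1-t^{48})(1-t^{54})},$$ where $$g(t)=1+t^{20}+t^{22}+t^{26}-t^{30}+t^{40}+t^{42}+t^{44}+t^{46}+t^{48}-t^{50}-t^{56}+t^{58}+t^{60}+t^{64}-t^{68}+t^{76}.$$ -/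

import Mathlib

open scoped TensorProduct

namespace WeylE6

noncomputable section

/-- The cohomology ring of `BT` with coefficients in the field with three elements, for `T` a maximal
torus of `E₆`: the polynomial ring in six generators `t, t₁, …, t₅`, all of degree `2`. -/
abbrev HBT : Type := MvPolynomial (Fin 6) (ZMod 3)

/-- The generator `t`. -/
def t : HBT := MvPolynomial.X 0

/-- The generators `t₁, …, t₅` (indexed from `0` to `4`). -/
def ti (i : Fin 5) : HBT := MvPolynomial.X i.succ

/-- The `k`-th elementary symmetric function of `t₁, …, t₅`. -/
def c (k : ℕ) : HBT := MvPolynomial.aeval ti (MvPolynomial.esymm (Fin 5) (ZMod 3) k)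

/-- The `k`-th elementary symmetric function of `t₁², …, t₅²`. -/
def p (k : ℕ) : HBT :=
  MvPolynomial.aeval (fun i => ti i ^ 2) (MvPolynomial.esymm (Fin 5) (ZMod 3) k)

/-! The elements of low degree; the index of an element is its degree. -/

def x4 : HBT := p 1

def x8 : HBT := p 2 - p 1 ^ 2

def y10 : HBT := c 5 - t * x8 - t ^ 3 * x4

def h12 : HBT := p 3 + t * y10 - t ^ 2 * x8 - t ^ 4 * x4

def h16 : HBT := p 4 + t ^ 3 * y10 - t ^ 4 * x8 - t ^ 6 * x4

def h18 : HBT :=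
  t * (h16 - x8 ^ 2) + t ^ 3 * (-h12 + x4 * x8) + t ^ 5 * x8 - t ^ 7 * x4 + t ^ 9

def x20 : HBT := h12 * x8 + h16 * x4

def y22 : HBT := h12 * y10 - h18 * x4

def y26 : HBT := h16 * y10 + h18 * x8

def g24 : HBT :=
  -t ^ 8 * x8 + t ^ 7 * y10 - t ^ 6 * x4 ^ 3 + t ^ 6 * x4 * x8
    + t ^ 4 * x4 ^ 2 * x8 - t ^ 4 * x8 ^ 2 + t ^ 3 * h18
    + t ^ 3 * x4 ^ 2 * y10 - t ^ 3 * x8 * y10 + t ^ 2 * x20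
    - t ^ 2 * y10 ^ 2 - t * y22 - t * x4 * x8 * y10

def x36 : HBT :=
  -g24 * x4 ^ 3 + h12 ^ 3 - h12 ^ 2 * x4 * x8 - h12 * x20 * x4 + h12 * x4 ^ 2 * x8 ^ 2

/-! The elements of high degree. Each of them is also a quotient by a power of `x4`; this is the
content of the lemmas `x4_pow_mul_x48`, …, `x4_mul_y76` below, which determine the elements because
`HBT` is an integral domain. -/

def x48 : HBT := h16 ^ 3 + h16 ^ 2 * x8 ^ 2 + h16 * x8 ^ 4 + g24 * x8 ^ 3

def x54 : HBT :=
  h18 ^ 3 - h16 * h18 * y10 ^ 2 + h18 ^ 2 * x8 * y10 + h18 * x8 ^ 2 * y10 ^ 2 - g24 * y10 ^ 3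

def y58 : HBT :=
  (h16 ^ 2 * h18 - h16 ^ 2 * x8 * y10 - h16 * x8 ^ 3 * y10 - g24 * x8 ^ 2 * y10
      + y26 * x8 ^ 3) * x4 ^ 2
    + (h16 ^ 2 * y22 + h16 * h18 * x20 + x20 * y26 * x8 + y22 * x8 ^ 4) * x4
    + (h16 * x20 * y22 + h18 * x20 ^ 2 + x20 * y22 * x8 ^ 2)

def y64 : HBT :=
  (h16 ^ 2 * h18 * y10 - h16 ^ 2 * x8 * y10 ^ 2 + h16 * h18 * y26 - h16 * x8 ^ 3 * y10 ^ 2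
      - g24 * x8 ^ 2 * y10 ^ 2) * x4
    + (y26 ^ 2 * x8 + y26 * x8 ^ 3 * y10) * x4
    + (h16 * y22 * y26 + h18 * x20 * y26 - y22 * y26 * x8 ^ 2 + y22 * x8 ^ 4 * y10)

def y60 : HBT :=
  (-h16 * h18 ^ 2 - h16 ^ 2 * y10 ^ 2 - h16 * x8 ^ 2 * y10 ^ 2 - g24 * x8 * y10 ^ 2
      + y26 ^ 2 + x8 ^ 2 * y10 * y26) * x4 ^ 2
    + (h16 * h18 * y22 + h18 ^ 2 * x20 - y22 * y26 * x8 + y22 * x8 ^ 3 * y10) * x4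
    + (-h16 * y22 ^ 2 - h18 * x20 * y22 + y22 ^ 2 * x8 ^ 2)

def y76 : HBT :=
  (-h16 ^ 2 * y10 - h16 * x8 ^ 2 * y10 - g24 * x8 * y10 + x8 ^ 2 * y26) * y26 * x4 ^ 2
    + (h16 ^ 2 * h18 * y22 - h16 * h18 ^ 2 * x20 + h16 ^ 2 * y22 * x8 * y10
      + h16 * y22 * x8 ^ 3 * y10) * x4
    + (g24 * y22 * x8 ^ 2 * y10 + x20 * y26 ^ 2) * x4
    + (h16 ^ 2 * y22 ^ 2 - h16 * h18 * x20 * y22 + h18 ^ 2 * x20 ^ 2 - y22 ^ 2 * x8 ^ 4)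

theorem x4_mul_y26 : x4 * y26 = x20 * y10 - y22 * x8 := by
  simp only [x20, y22, y26]; ring

theorem x4_pow_mul_x48 : x4 ^ 3 * x48 =
    -x36 * x8 ^ 3 + x20 ^ 3 + x20 ^ 2 * x4 * x8 ^ 2 + x20 * x4 ^ 2 * x8 ^ 4 := by
  simp only [x48, x36, x20]; generalize g24 = g; grind

theorem x4_pow_mul_x54 : x4 ^ 3 * x54 =
    x36 * y10 ^ 3 - y22 ^ 3 + x20 * y22 * x4 * y10 ^ 2 + y22 ^ 2 * x4 * x8 * y10
      - y22 * x4 ^ 2 * x8 ^ 2 * y10 ^ 2 := by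
  simp only [x54, x36, x20, y22]; generalize g24 = g; grind

theorem x4_mul_y58 : x4 * y58 = x36 * x8 ^ 2 * y10 - x20 ^ 2 * y22 := by
  simp only [y58, x36, x20, y22, y26]; generalize g24 = g; grind

theorem x4_mul_y64 : x4 * y64 = y58 * y10 - x20 * y22 * y26 - y22 ^ 2 * x8 ^ 3 := by
  simp only [y64, y58, x20, y22, y26]; generalize g24 = g; grind

theorem x4_mul_y60 : x4 * y60 = x36 * x8 * y10 ^ 2 - x20 * y22 ^ 2 := by
  simp only [y60, x36, x20, y22, y26]; generalize g24 = g; grind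

theorem x4_mul_y76 : x4 * y76 = y58 * y22 + y60 * x20 + x20 * y22 ^ 2 * x8 ^ 2 := by
  simp only [y76, y58, y60, x20, y22, y26]; generalize g24 = g; grind

/-- Names of the thirteen generators. -/
inductive Gen
  | x4 | x8 | y10 | x20 | y22 | y26 | x36 | x48 | x54 | y58 | y60 | y64 | y76

/-- The thirteen generators as elements of the cohomology ring. -/
def Gen.val : Gen → HBT
  | .x4 => WeylE6.x4
  | .x8 => WeylE6.x8
  | .y10 => WeylE6.y10
  | .x20 => WeylE6.x20
  | .y22 => WeylE6.y22
  | .y26 => WeylE6.y26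
  | .x36 => WeylE6.x36
  | .x48 => WeylE6.x48
  | .x54 => WeylE6.x54
  | .y58 => WeylE6.y58
  | .y60 => WeylE6.y60
  | .y64 => WeylE6.y64
  | .y76 => WeylE6.y76

/-- The algebra generated by the thirteen elements. -/
def A : Subalgebra (ZMod 3) HBT := Algebra.adjoin (ZMod 3) (Set.range Gen.val)

/-- The thirteen generators as elements of `A`. -/
def a (g : Gen) : A := ⟨g.val, Algebra.subset_adjoin (Set.mem_range_self g)⟩

/-- The formal module `C`: the free module of rank nine over a polynomial ring in three variables
(standing for `x4, x8, y10`) plus the free module of rank five over a polynomial ring in two variables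
(standing for `x8, y10`). -/
abbrev C : Type :=
  (Fin 9 →₀ MvPolynomial (Fin 3) (ZMod 3)) × (Fin 5 →₀ MvPolynomial (Fin 2) (ZMod 3))

/-- The formal polynomial ring in three variables, standing for `x36, x48, x54`. -/
abbrev Q : Type := MvPolynomial (Fin 3) (ZMod 3)

/-- The elements of `A` attached to the basis of the first summand of `C`. -/
def γ : Fin 9 → A :=
  ![1, a .x20, a .x20 ^ 2, a .y22, a .y22 ^ 2, a .x20 * a .y22, a .y58, a .y60, a .y76]

/-- The elements of `A` attached to the basis of the second summand of `C`. -/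
def δ : Fin 5 → A :=
  ![a .y26, a .y26 ^ 2, a .x20 * a .y26, a .y22 * a .y26, a .y64]

/-- The linear map `C → A` which evaluates the coefficients at `x4, x8, y10` and at `x8, y10`, and the
basis vectors at `γ` and `δ`. -/
def evalC : C →ₗ[ZMod 3] A :=
  LinearMap.coprod
    (Finsupp.lsum (ZMod 3) fun i =>
      LinearMap.mulRight (ZMod 3) (γ i) ∘ₗ
        (MvPolynomial.aeval (R := ZMod 3) ![a .x4, a .x8, a .y10]).toLinearMap)
    (Finsupp.lsum (ZMod 3) fun j =>
      LinearMap.mulRight (ZMod 3) (δ j) ∘ₗ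
        (MvPolynomial.aeval (R := ZMod 3) ![a .x8, a .y10]).toLinearMap)

/-- The linear map `Q → A` which evaluates a polynomial at `x36, x48, x54`. -/
def evalQ : Q →ₗ[ZMod 3] A :=
  (MvPolynomial.aeval (R := ZMod 3) ![a .x36, a .x48, a .x54]).toLinearMap

/-- The linear map `σ : C ⊗ Q → A`, `u ⊗ v ↦ evalC u * evalQ v`. -/
def σ : C ⊗[ZMod 3] Q →ₗ[ZMod 3] A :=
  LinearMap.mul' (ZMod 3) A ∘ₗ TensorProduct.map evalC evalQ

/-- The elements of `HBT` of cohomological degree `n`; all six variables have degree `2`. -/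
def degreePart (n : ℕ) : Submodule (ZMod 3) HBT :=
  MvPolynomial.weightedHomogeneousSubmodule (ZMod 3) (fun _ : Fin 6 => 2) n

/-- The part of degree `n` of a subspace of `HBT`. -/
def gradedPiece (V : Submodule (ZMod 3) HBT) (n : ℕ) : Submodule (ZMod 3) HBT :=
  V ⊓ degreePart n

/-- The Poincaré series of a subspace of `HBT`. -/
def poincareSeries (V : Submodule (ZMod 3) HBT) : PowerSeries ℤ :=
  PowerSeries.mk fun n => (Module.finrank (ZMod 3) (gradedPiece V n) : ℤ)

end

end WeylE6

/-!
The ring `HBT` is integral over the subalgebra generated by the six parameters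
`t, x4, x8, y10, h12, h16`, because each `tᵢ²` is a root of the polynomial whose coefficients are
`p 1, …, p 5`; hence the parameters are algebraically independent
(`algebraicIndependent_param`), and an element which is a polynomial in them may be studied through
its leading monomial.

Let `v` be the family of values of `σ` on the monomial basis of `C ⊗ Q`.

*Surjectivity of `σ`.* After inverting `x4`, every generator is a polynomial in
`x4, x8, y10, x20, y22, x36` (`map_generators`), so that any identity between the generators can be
checked in a field containing `HBT` by clearing denominators. In this way the products `x4 * δ`, the
cubic monomials in `x20, y22, y26`, the products of these three with `y58, y60, y64, y76`, and the
products of two of the last four are written as combinations of the basis symbols of `C` with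
coefficients in `x4, x8, y10, x36, x48, x54` (`cubic_relations`, `mixed_relations`,
`high_relations`). These relations suffice to see that the span of `v` is stable under
multiplication by all thirteen generators, so that it equals `A` (`toSubmodule_A`).

*Injectivity of `σ`.* Give the parameters `t, h12, h16` the weights `1, 5, 7`, and `x4, x8, y10` the
weight `0`. With these weights the part of highest weight of each generator is a single monomial:
`h18` starts with `t ^ 9`, then `x20` with `h16 * x4`, `y22` with `-t ^ 9 * x4`, `x36` with
`h12 ^ 3`, and the remaining generators are handled through the exact divisions by powers of `x4`
that determine them, since leading monomials are multiplicative (`HasLead.of_mul`). The leading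
monomials of the members of `v` turn out to be pairwise distinct (`leadV_injective`), so `v` is
linearly independent.

*Poincaré series.* All members of `v` are homogeneous. Hence `A` is graded, `A_n` has as a basis the
members of `v` of degree `n`, and the generating series which counts them is a sum of monomials
times products of geometric series.
-/

/-! ### Algebraic independence of the parameters -/

namespace WeylE6

noncomputable section

open MvPolynomial in
/-- The elements `ti i ^ 2` are the roots of the polynomial with coefficients `± p k`. -/
theorem sum_p_mul_pow (i : Fin 5) :
    ∑ k ∈ Finset.range 6, p k * (-(ti i ^ 2)) ^ (5 - k) = 0 := by
  have h := congrArg (Polynomial.map (aeval (R := ZMod 3) fun i => ti i ^ 2).toRingHom)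
    (MvPolynomial.prod_C_add_X_eq_sum_esymm (R := ZMod 3) (σ := Fin 5))
  -- The factor with index `i` of the product vanishes at `-(ti i ^ 2)`.
  have h2 := congrArg (Polynomial.eval (-(ti i ^ 2))) h
  simp only [Polynomial.map_prod, Polynomial.map_add, Polynomial.map_X, Polynomial.map_C,
    Polynomial.eval_prod, Polynomial.eval_add, Polynomial.eval_X, Polynomial.eval_C,
    Polynomial.map_sum, Polynomial.map_mul, Polynomial.map_pow, Polynomial.eval_finsetSum,
    Polynomial.eval_mul, Polynomial.eval_pow, Fintype.card_fin] at h2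
  rw [Finset.prod_eq_zero (Finset.mem_univ i) (by simp)] at h2
  exact h2.symm

open MvPolynomial in
theorem c_five : c 5 = ∏ i, ti i := by
  have : Finset.powersetCard 5 (Finset.univ : Finset (Fin 5)) = {Finset.univ} :=
    Finset.powersetCard_self Finset.univ
  simp [c, esymm, this]

open MvPolynomial in
theorem p_five : p 5 = c 5 ^ 2 := by
  have : Finset.powersetCard 5 (Finset.univ : Finset (Fin 5)) = {Finset.univ} :=
    Finset.powersetCard_self Finset.univ
  simp [c_five, p, esymm, this, Finset.prod_pow]

/-- The parameters: `HBT` is integral over the subalgebra which they generate. -/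
def param : Fin 6 → HBT := ![t, x4, x8, y10, h12, h16]

theorem isIntegral_ti (B : Subalgebra (ZMod 3) HBT) (h : ∀ i, param i ∈ B) (i : Fin 5) :
    IsIntegral B (ti i) := by
  have ht : t ∈ B := h 0
  have h4 : x4 ∈ B := h 1
  have h8 : x8 ∈ B := h 2
  have h10 : y10 ∈ B := h 3
  have h12 : h12 ∈ B := h 4
  have h16 : h16 ∈ B := h 5
  have hp1 : p 1 ∈ B := h4
  have hp2 : p 2 ∈ B := by
    have : p 2 = x8 + x4 ^ 2 := by simp [x8, x4]
    rw [this]; exact add_mem h8 (pow_mem h4 2)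
  have hp3 : p 3 ∈ B := by
    have : p 3 = WeylE6.h12 - t * y10 + t ^ 2 * x8 + t ^ 4 * x4 := by
      simp only [WeylE6.h12]; ring
    rw [this]
    exact add_mem (add_mem (sub_mem h12 (mul_mem ht h10)) (mul_mem (pow_mem ht 2) h8))
      (mul_mem (pow_mem ht 4) h4)
  have hp4 : p 4 ∈ B := by
    have : p 4 = WeylE6.h16 - t ^ 3 * y10 + t ^ 4 * x8 + t ^ 6 * x4 := by
      simp only [WeylE6.h16]; ring
    rw [this]
    exact add_mem (add_mem (sub_mem h16 (mul_mem (pow_mem ht 3) h10)) (mul_mem (pow_mem ht 4) h8))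
      (mul_mem (pow_mem ht 6) h4)
  have hp5 : p 5 ∈ B := by
    have : c 5 = y10 + t * x8 + t ^ 3 * x4 := by simp only [y10]; ring
    rw [p_five, this]
    exact pow_mem (add_mem (add_mem h10 (mul_mem ht h8)) (mul_mem (pow_mem ht 3) h4)) 2
  have hp0 : p 0 = 1 := by simp [p]
  have key := sum_p_mul_pow i
  simp only [Finset.sum_range_succ, Finset.sum_range_zero, hp0] at key
  have hu : IsIntegral B (-(ti i ^ 2)) := by
    refine ⟨Polynomial.X ^ 5 + Polynomial.C ⟨p 1, hp1⟩ * Polynomial.X ^ 4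
      + Polynomial.C ⟨p 2, hp2⟩ * Polynomial.X ^ 3 + Polynomial.C ⟨p 3, hp3⟩ * Polynomial.X ^ 2
      + Polynomial.C ⟨p 4, hp4⟩ * Polynomial.X + Polynomial.C ⟨p 5, hp5⟩, by monicity!, ?_⟩
    simp only [Polynomial.eval₂_add, Polynomial.eval₂_mul, Polynomial.eval₂_X_pow,
      Polynomial.eval₂_C, Polynomial.eval₂_X, Subalgebra.algebraMap_def]
    linear_combination key
  exact IsIntegral.of_pow (n := 2) (by norm_num) (by simpa using hu.neg)

theorem algebraicIndependent_param : AlgebraicIndependent (ZMod 3) param := by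
  let B := Algebra.adjoin (ZMod 3) (Set.range param)
  have hB : ∀ i, param i ∈ B := fun i => Algebra.subset_adjoin ⟨i, rfl⟩
  have hX : ∀ i : Fin 6, IsIntegral B (MvPolynomial.X i : HBT) := by
    intro i
    refine Fin.cases ?_ (fun j => isIntegral_ti B hB j) i
    exact isIntegral_algebraMap (R := B) (x := ⟨t, hB 0⟩)
  have : Algebra.IsIntegral B HBT := by
    refine ⟨fun f => ?_⟩
    induction f using MvPolynomial.induction_on with
    | C a => exact isIntegral_algebraMap (R := B) (x := algebraMap (ZMod 3) B a)
    | add f g hf hg => exact hf.add hg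
    | mul_X f i hf => exact hf.mul (hX i)
  have : Algebra.IsAlgebraic (Algebra.adjoin (ZMod 3) (Set.range param)) HBT :=
    Algebra.IsIntegral.isAlgebraic (R := B)
  -- Six elements over which a ring of transcendence degree six is algebraic are independent.
  refine (Algebra.IsAlgebraic.isTranscendenceBasis_of_le_trdeg_of_finite (ZMod 3) param ?_).1
  rw [MvPolynomial.trdeg_of_isDomain]
  simp

theorem x4_ne_zero : x4 ≠ 0 := algebraicIndependent_param.ne_zero 1

end

end WeylE6

/-! ### Relations between the generators -/

namespace WeylE6

noncomputable section

/-- `HBT` embeds into a field. The field is left unspecified because computations in an arbitrary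
field of characteristic three elaborate faster than in the concrete field of fractions. -/
theorem exists_field_embedding :
    ∃ (K : Type) (_ : Field K) (_ : CharP K 3) (φ : HBT →+* K), Function.Injective φ :=
  ⟨FractionRing HBT, inferInstance,
    charP_of_injective_algebraMap (IsFractionRing.injective HBT (FractionRing HBT)) 3,
    algebraMap HBT (FractionRing HBT), IsFractionRing.injective HBT (FractionRing HBT)⟩

/-- In a field containing `HBT`, all the generators are polynomials in `x4, x8, y10, x20, y22, x36`
divided by a power of `x4`. -/
theorem map_generators {K : Type*} [Field K] (φ : HBT →+* K) (hφ : Function.Injective φ) :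
    φ y26 = (φ x20 * φ y10 - φ y22 * φ x8) / φ x4 ∧
    φ x48 = (-φ x36 * φ x8 ^ 3 + φ x20 ^ 3
      + φ x20 ^ 2 * φ x4 * φ x8 ^ 2
      + φ x20 * φ x4 ^ 2 * φ x8 ^ 4) / φ x4 ^ 3 ∧
    φ x54 = (φ x36 * φ y10 ^ 3 - φ y22 ^ 3
      + φ x20 * φ y22 * φ x4 * φ y10 ^ 2
      + φ y22 ^ 2 * φ x4 * φ x8 * φ y10
      - φ y22 * φ x4 ^ 2 * φ x8 ^ 2 * φ y10 ^ 2) / φ x4 ^ 3 ∧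
    φ y58 = (φ x36 * φ x8 ^ 2 * φ y10
      - φ x20 ^ 2 * φ y22) / φ x4 ∧
    φ y60 = (φ x36 * φ x8 * φ y10 ^ 2
      - φ x20 * φ y22 ^ 2) / φ x4 ∧
    φ y64 = (φ x36 * φ x8 ^ 2 * φ y10 ^ 2
      + φ x20 ^ 2 * φ y22 * φ y10 + φ x20 * φ y22 ^ 2 * φ x8
      - φ x4 * φ y22 ^ 2 * φ x8 ^ 3) / φ x4 ^ 2 ∧
    φ y76 = (φ x36 * φ x8 ^ 2 * φ y10 * φ y22
      + φ x36 * φ x8 * φ y10 ^ 2 * φ x20 + φ x20 ^ 2 * φ y22 ^ 2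
      + φ x4 * φ x20 * φ y22 ^ 2 * φ x8 ^ 2) / φ x4 ^ 2 := by
  have hx : φ x4 ≠ 0 := (map_ne_zero_iff φ hφ).2 x4_ne_zero
  -- One more factor `x4` clears the denominators of `y58` and `y60`; the multiples of `3` come from
  -- `-2 = 1`.
  have h64 : x4 ^ 2 * y64 = x36 * x8 ^ 2 * y10 ^ 2 + x20 ^ 2 * y22 * y10 + x20 * y22 ^ 2 * x8
      - x4 * y22 ^ 2 * x8 ^ 3 := by
    linear_combination x4 * x4_mul_y64 + y10 * x4_mul_y58 - x20 * y22 * x4_mul_y26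
      - x20 ^ 2 * y22 * y10 * CharP.cast_eq_zero HBT 3
  have h76 : x4 ^ 2 * y76 = x36 * x8 ^ 2 * y10 * y22 + x36 * x8 * y10 ^ 2 * x20
      + x20 ^ 2 * y22 ^ 2 + x4 * x20 * y22 ^ 2 * x8 ^ 2 := by
    linear_combination x4 * x4_mul_y76 + y22 * x4_mul_y58 + x20 * x4_mul_y60
      - x20 ^ 2 * y22 ^ 2 * CharP.cast_eq_zero HBT 3
  refine ⟨?_, ?_, ?_, ?_, ?_, ?_, ?_⟩
  · rw [eq_div_iff hx, mul_comm]; simpa using congrArg φ x4_mul_y26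
  · rw [eq_div_iff (pow_ne_zero 3 hx), mul_comm]; simpa using congrArg φ x4_pow_mul_x48
  · rw [eq_div_iff (pow_ne_zero 3 hx), mul_comm]; simpa using congrArg φ x4_pow_mul_x54
  · rw [eq_div_iff hx, mul_comm]; simpa using congrArg φ x4_mul_y58
  · rw [eq_div_iff hx, mul_comm]; simpa using congrArg φ x4_mul_y60
  · rw [eq_div_iff (pow_ne_zero 2 hx), mul_comm]; simpa using congrArg φ h64
  · rw [eq_div_iff (pow_ne_zero 2 hx), mul_comm]; simpa using congrArg φ h76

set_option maxHeartbeats 4000000 in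
/-- The multiples by `x4` of the basis elements of the second summand are combinations of basis
elements with coefficients free of `x4`. -/
theorem x4_mul_relations :
    x4 * y26 = -x8 * y22 + y10 * x20 ∧
    x4 * y26 ^ 2 = -x8 * (y22 * y26) + y10 * (x20 * y26) ∧
    x4 * x20 * y26 = -x8 * (x20 * y22) + y10 * x20 ^ 2 ∧
    x4 * y22 * y26 = -x8 * y22 ^ 2 + y10 * (x20 * y22) ∧
    x4 * y64 = -x8 * y60 - y10 * y58 - x8 ^ 3 * y22 ^ 2 := by
  obtain ⟨K, _, _, φ, hφ⟩ := exists_field_embedding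
  have hx : φ x4 ≠ 0 := (map_ne_zero_iff φ hφ).2 x4_ne_zero
  obtain ⟨h26, h48, h54, h58, h60, h64, h76⟩ := map_generators φ hφ
  refine ⟨?_, ?_, ?_, ?_, ?_⟩ <;>
  · apply hφ
    simp only [map_add, map_sub, map_neg, map_mul, map_pow, h26, h58, h60, h64]
    clear h26 h48 h54 h58 h60 h64 h76
    field_simp
    grind

set_option maxHeartbeats 4000000 in
/-- The cubic monomials in `x20, y22, y26` as combinations of basis elements. -/
theorem cubic_relations :
    x20 * x20 * x20 = -x4 * x8 ^ 2 * x20 ^ 2 - x4 ^ 2 * x8 ^ 4 * x20 + x4 ^ 3 * x48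
      + x8 ^ 3 * x36 ∧
    x20 * x20 * y22 = -x4 * y58 + x8 ^ 2 * y10 * x36 ∧
    x20 * x20 * y26 = x8 * y58 - x8 ^ 2 * y10 * x20 ^ 2 - x4 * x8 ^ 4 * y10 * x20
      + x4 ^ 2 * y10 * x48 ∧
    x20 * y22 * y22 = -x4 * y60 + x8 * y10 ^ 2 * x36 ∧
    x20 * y22 * y26 = x8 * y60 - y10 * y58 ∧
    x20 * y26 * y26 = x8 * y64 - x8 ^ 3 * (y22 * y26) - x8 ^ 2 * y10 * (x20 * y26)
      - x8 ^ 4 * y10 ^ 2 * x20 + x4 * y10 ^ 2 * x48 ∧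
    y22 * y22 * y22 = x4 * x8 * y10 * y22 ^ 2 + x4 * y10 ^ 2 * (x20 * y22)
      - x4 ^ 2 * x8 ^ 2 * y10 ^ 2 * y22 - x4 ^ 3 * x54 + y10 ^ 3 * x36 ∧
    y22 * y22 * y26 = -y10 * y60 - x8 ^ 2 * y10 * y22 ^ 2 - x8 * y10 ^ 2 * (x20 * y22)
      + x4 * x8 ^ 3 * y10 ^ 2 * y22 + x4 ^ 2 * x8 * x54 ∧
    y22 * y26 * y26 = y10 * y64 + x8 ^ 2 * y10 * (y22 * y26) - x8 ^ 4 * y10 ^ 2 * y22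
      - x4 * x8 ^ 2 * x54 ∧
    y26 * y26 * y26 = -x8 ^ 2 * y10 * y26 ^ 2 - x8 ^ 4 * y10 ^ 2 * y26 + x8 ^ 3 * x54
      + y10 ^ 3 * x48 := by
  obtain ⟨K, _, _, φ, hφ⟩ := exists_field_embedding
  have hx : φ x4 ≠ 0 := (map_ne_zero_iff φ hφ).2 x4_ne_zero
  obtain ⟨h26, h48, h54, h58, h60, h64, h76⟩ := map_generators φ hφ
  refine ⟨?_, ?_, ?_, ?_, ?_, ?_, ?_, ?_, ?_, ?_⟩ <;>
  · apply hφ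
    simp only [map_add, map_sub, map_neg, map_mul, map_pow, h26, h48, h54, h58, h60, h64]
    clear h26 h48 h54 h58 h60 h64 h76
    field_simp
    grind

set_option maxHeartbeats 4000000 in
/-- The products of `x20, y22, y26` with `y58, y60, y64, y76` as combinations of basis elements. -/
theorem mixed_relations :
    x20 * y58 = -x4 * x8 ^ 2 * y58 + x4 * x8 ^ 4 * (x20 * y22) - x4 ^ 2 * x48 * y22
      + x8 ^ 2 * x36 * y26 + x8 ^ 4 * y10 * x36 ∧
    x20 * y60 = -x4 * y76 - x4 * x8 ^ 2 * y60 - x8 * y10 * x36 * y26 + x8 ^ 3 * y10 ^ 2 * x36 ∧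
    x20 * y64 = x8 * y76 - x8 ^ 3 * y60 + x8 ^ 2 * y10 * y58 - x8 ^ 4 * y10 * (x20 * y22)
      + x4 * y10 * x48 * y22 ∧
    x20 * y76 = x4 * x8 ^ 4 * y60 + x4 * x48 * y22 ^ 2 + x8 * x36 * y26 ^ 2
      - x8 ^ 5 * y10 ^ 2 * x36 ∧
    y22 * y58 = -x4 * y76 - x4 * x8 ^ 2 * y60 + x8 * y10 * x36 * y26 + x8 ^ 3 * y10 ^ 2 * x36 ∧
    y22 * y60 = x4 * x8 * y10 * y60 + x4 * y10 ^ 2 * y58 + x4 * x8 ^ 2 * y10 ^ 2 * (x20 * y22)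
      - y10 ^ 2 * x36 * y26 + x4 ^ 2 * x54 * x20 + x8 ^ 2 * y10 ^ 3 * x36 ∧
    y22 * y64 = y10 * y76 - x8 * y10 ^ 2 * y58 - x8 ^ 4 * y10 * y22 ^ 2
      + x8 ^ 3 * y10 ^ 2 * (x20 * y22) + x4 * x8 ^ 5 * y10 ^ 2 * y22 - x4 * x8 * x54 * x20
      + x4 ^ 2 * x8 ^ 3 * x54 ∧
    y22 * y76 = x4 * x8 * y10 * y76 + x4 * x8 ^ 2 * y10 ^ 2 * y58 + y10 * x36 * y26 ^ 2
      + x4 * x8 ^ 4 * y10 ^ 2 * (x20 * y22) - x4 * x54 * x20 ^ 2 + x4 ^ 2 * y10 ^ 2 * x48 * y22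
      - x4 ^ 2 * x8 ^ 2 * x54 * x20 - x8 ^ 4 * y10 ^ 3 * x36 ∧
    y26 * y58 = x8 * y76 + x8 ^ 3 * y60 - x8 ^ 2 * y10 * y58 + x8 ^ 4 * y10 * (x20 * y22)
      - x4 * y10 * x48 * y22 ∧
    y26 * y60 = -y10 * y76 + x8 ^ 2 * y10 * y60 - x8 * y10 ^ 2 * y58
      - x8 ^ 3 * y10 ^ 2 * (x20 * y22) - x4 * x8 * x54 * x20 ∧
    y26 * y64 = x8 ^ 2 * y10 * y64 + x8 ^ 4 * y10 * (y22 * y26) - x8 ^ 6 * y10 ^ 2 * y22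
      + y10 ^ 2 * x48 * y22 + x8 ^ 2 * x54 * x20 - x4 * x8 ^ 4 * x54 ∧
    y26 * y76 = -x8 ^ 2 * y10 * y76 + x8 ^ 4 * y10 * y60 - x8 ^ 3 * y10 ^ 2 * y58
      + y10 * x48 * y22 ^ 2 - x8 ^ 5 * y10 ^ 2 * (x20 * y22) + x8 * x54 * x20 ^ 2
      - x4 * x8 * y10 ^ 2 * x48 * y22 + x4 * x8 ^ 3 * x54 * x20 := by
  obtain ⟨K, _, _, φ, hφ⟩ := exists_field_embedding
  have hx : φ x4 ≠ 0 := (map_ne_zero_iff φ hφ).2 x4_ne_zero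
  obtain ⟨h26, h48, h54, h58, h60, h64, h76⟩ := map_generators φ hφ
  refine ⟨?_, ?_, ?_, ?_, ?_, ?_, ?_, ?_, ?_, ?_, ?_, ?_⟩ <;>
  · apply hφ
    simp only [map_add, map_sub, map_neg, map_mul, map_pow, h26, h48, h54, h58, h60, h64, h76]
    clear h26 h48 h54 h58 h60 h64 h76
    field_simp
    grind

set_option maxRecDepth 10000 in
set_option maxHeartbeats 4000000 in
/-- The products of two of `y58, y60, y64, y76` as combinations of basis elements. -/
theorem high_relations :
    y58 * y58 = -x4 ^ 2 * x8 ^ 6 * y60 - x4 ^ 2 * x48 * y60 + x8 ^ 2 * x36 * y64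
      - x4 ^ 2 * x8 ^ 2 * x48 * y22 ^ 2 + x4 * x8 ^ 7 * y10 ^ 2 * x36
      + x4 * x8 * y10 ^ 2 * x36 * x48 ∧
    y58 * y60 = -x4 ^ 2 * x8 ^ 3 * y10 * y76 - x8 * y10 * x36 * y64
      - x4 ^ 2 * x8 ^ 4 * y10 ^ 2 * y58 + x4 ^ 2 * x8 * y10 * x48 * y22 ^ 2
      - x4 ^ 2 * x8 ^ 6 * y10 ^ 2 * (x20 * y22) + x4 ^ 2 * y10 ^ 2 * x48 * (x20 * y22)
      - x8 ^ 2 * y10 ^ 2 * x36 * (x20 * y26) + x4 ^ 2 * x8 ^ 2 * x54 * x20 ^ 2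
      + x4 ^ 3 * x8 ^ 2 * y10 ^ 2 * x48 * y22 - x8 ^ 5 * y10 ^ 2 * x36 * y22
      + x4 ^ 3 * x8 ^ 4 * x54 * x20 - x4 ^ 4 * x48 * x54 + x4 * x8 ^ 6 * y10 ^ 3 * x36
      - x4 * x8 ^ 3 * x36 * x54 + x4 * y10 ^ 3 * x36 * x48 ∧
    y58 * y64 = -x4 * x8 ^ 4 * y10 * y76 - x4 * x8 ^ 6 * y10 * y60 + x4 * y10 * x48 * y60
      - x8 ^ 3 * y10 * x36 * y26 ^ 2 - x4 * x8 * y10 ^ 2 * x48 * (x20 * y22)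
      + x4 * x8 ^ 3 * x54 * x20 ^ 2 - x8 ^ 5 * y10 ^ 2 * x36 * y26 - x4 ^ 2 * x8 ^ 5 * x54 * x20
      + x4 ^ 3 * x8 * x48 * x54 + x8 ^ 7 * y10 ^ 3 * x36 + x8 ^ 4 * x36 * x54
      + x8 * y10 ^ 3 * x36 * x48 ∧
    y58 * y76 = x4 ^ 2 * x8 ^ 5 * y10 * y76 + x4 ^ 2 * x8 ^ 7 * y10 * y60
      + x4 ^ 2 * x8 * y10 * x48 * y60 - x4 ^ 2 * x8 ^ 6 * y10 ^ 2 * y58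
      + x4 ^ 2 * y10 ^ 2 * x48 * y58 - x4 ^ 2 * x8 ^ 8 * y10 ^ 2 * (x20 * y22)
      + x4 ^ 2 * x8 ^ 2 * y10 ^ 2 * x48 * (x20 * y22) + x8 ^ 4 * y10 ^ 2 * x36 * (x20 * y26)
      - x4 ^ 2 * x8 ^ 4 * x54 * x20 ^ 2 + x4 ^ 3 * x8 ^ 4 * y10 ^ 2 * x48 * y22
      - x8 * y10 ^ 2 * x36 * x48 * y22 + x4 ^ 3 * x48 * x54 * x20 - x8 ^ 6 * y10 ^ 3 * x36 * x20
      + x8 ^ 3 * x36 * x54 * x20 - y10 ^ 3 * x36 * x48 * x20 + x4 * x8 ^ 2 * y10 ^ 3 * x36 * x48 ∧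
    y60 * y60 = -x4 ^ 2 * x8 ^ 2 * y10 ^ 2 * y76 + y10 ^ 2 * x36 * y64
      - x4 ^ 2 * x8 ^ 3 * y10 ^ 3 * y58 + x4 ^ 2 * x54 * y58 + x4 ^ 2 * y10 ^ 2 * x48 * y22 ^ 2
      + x8 ^ 2 * y10 ^ 2 * x36 * (y22 * y26) - x4 ^ 2 * x8 ^ 5 * y10 ^ 3 * (x20 * y22)
      + x8 * y10 ^ 3 * x36 * (x20 * y26) - x4 ^ 2 * x8 * y10 * x54 * x20 ^ 2
      + x4 ^ 3 * x8 * y10 ^ 3 * x48 * y22 - x8 ^ 4 * y10 ^ 3 * x36 * y22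
      + x8 ^ 3 * y10 ^ 4 * x36 * x20 + x4 * x8 ^ 5 * y10 ^ 4 * x36
      - x4 * x8 ^ 2 * y10 * x36 * x54 ∧
    y60 * y64 = x4 * x8 ^ 5 * y10 ^ 2 * y60 + x4 * x8 ^ 4 * y10 ^ 3 * y58 - x4 * x8 * x54 * y58
      + x4 * x8 * y10 ^ 2 * x48 * y22 ^ 2 + x4 * x8 ^ 6 * y10 ^ 3 * (x20 * y22)
      - x4 * x8 ^ 3 * x54 * (x20 * y22) - x4 * y10 ^ 3 * x48 * (x20 * y22)
      + x4 ^ 2 * x8 ^ 2 * y10 ^ 3 * x48 * y22 - x8 ^ 4 * y10 ^ 3 * x36 * y26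
      + x4 ^ 2 * x8 ^ 4 * y10 * x54 * x20 + x4 ^ 3 * y10 * x48 * x54 + x8 ^ 6 * y10 ^ 4 * x36
      - x8 ^ 3 * y10 * x36 * x54 - y10 ^ 4 * x36 * x48 ∧
    y60 * y76 = x4 ^ 2 * x8 ^ 4 * y10 ^ 2 * y76 + x4 ^ 2 * x8 ^ 6 * y10 ^ 2 * y60
      + x4 ^ 2 * y10 ^ 2 * x48 * y60 - x8 ^ 2 * y10 ^ 2 * x36 * y64
      - x4 ^ 2 * x8 ^ 5 * y10 ^ 3 * y58 + x8 ^ 4 * y10 ^ 2 * x36 * (y22 * y26)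
      - x4 ^ 2 * x8 ^ 7 * y10 ^ 3 * (x20 * y22) - x4 ^ 2 * x8 ^ 4 * x54 * (x20 * y22)
      - x4 ^ 2 * x8 * y10 ^ 3 * x48 * (x20 * y22) + x4 ^ 3 * x8 ^ 3 * y10 ^ 3 * x48 * y22
      + x4 ^ 3 * x48 * x54 * y22 + x8 ^ 3 * x36 * x54 * y22 - y10 ^ 3 * x36 * x48 * y22
      - x4 ^ 3 * x8 ^ 5 * y10 * x54 * x20 + x8 ^ 2 * y10 * x36 * x54 * x20
      + x4 ^ 4 * x8 * y10 * x48 * x54 + x4 * x8 ^ 4 * y10 * x36 * x54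
      + x4 * x8 * y10 ^ 4 * x36 * x48 ∧
    y64 * y64 = -x8 ^ 4 * y10 ^ 2 * y76 - y10 ^ 2 * x48 * y60 + x8 ^ 5 * y10 ^ 3 * y58
      + x8 ^ 2 * x54 * y58 - x8 ^ 2 * y10 ^ 2 * x48 * y22 ^ 2 - x8 ^ 7 * y10 ^ 3 * (x20 * y22)
      - x8 ^ 4 * x54 * (x20 * y22) - x8 * y10 ^ 3 * x48 * (x20 * y22)
      - x4 * x8 ^ 9 * y10 ^ 3 * y22 - x4 * x8 ^ 6 * x54 * y22 + x4 * x8 ^ 3 * y10 ^ 3 * x48 * y22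
      + x4 * x8 ^ 5 * y10 * x54 * x20 - x4 ^ 2 * x8 ^ 7 * y10 * x54
      + x4 ^ 2 * x8 * y10 * x48 * x54 ∧
    y64 * y76 = x4 * x8 ^ 5 * y10 ^ 2 * y76 + x4 * x8 * y10 ^ 2 * x48 * y60
      + x4 * x8 ^ 6 * y10 ^ 3 * y58 - x4 * x8 ^ 3 * x54 * y58 - x4 * y10 ^ 3 * x48 * y58
      - x4 * x8 ^ 3 * y10 ^ 2 * x48 * y22 ^ 2 + x8 ^ 4 * y10 ^ 2 * x36 * y26 ^ 2
      + x4 * x8 ^ 8 * y10 ^ 3 * (x20 * y22) - x4 * x8 ^ 5 * x54 * (x20 * y22)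
      - x4 * x8 ^ 4 * y10 * x54 * x20 ^ 2 - x4 ^ 2 * x8 * x48 * x54 * y22
      + x8 ^ 3 * x36 * x54 * y26 + y10 ^ 3 * x36 * x48 * y26 - x4 ^ 2 * x8 ^ 6 * y10 * x54 * x20
      - x4 ^ 2 * y10 * x48 * x54 * x20 - x4 ^ 3 * x8 ^ 2 * y10 * x48 * x54
      - x8 ^ 8 * y10 ^ 4 * x36 + x8 ^ 5 * y10 * x36 * x54 + x8 ^ 2 * y10 ^ 4 * x36 * x48 ∧
    y76 * y76 = x4 ^ 2 * y10 ^ 2 * x48 * y76 - x4 ^ 2 * x8 ^ 8 * y10 ^ 2 * y60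
      + x8 ^ 4 * y10 ^ 2 * x36 * y64 - x4 ^ 2 * x8 ^ 7 * y10 ^ 3 * y58
      - x4 ^ 2 * x8 ^ 4 * x54 * y58 - x4 ^ 2 * x8 * y10 ^ 3 * x48 * y58
      - x4 ^ 2 * x8 ^ 4 * y10 ^ 2 * x48 * y22 ^ 2 + y10 ^ 2 * x36 * x48 * (y22 * y26)
      - x4 ^ 2 * x8 ^ 9 * y10 ^ 3 * (x20 * y22) + x4 ^ 2 * x8 ^ 6 * x54 * (x20 * y22)
      - x4 ^ 2 * x48 * x54 * (x20 * y22) - x8 ^ 5 * y10 ^ 3 * x36 * (x20 * y26)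
      + x8 ^ 2 * x36 * x54 * (x20 * y26) + x4 ^ 2 * x8 ^ 5 * y10 * x54 * x20 ^ 2
      + x4 ^ 3 * x8 ^ 5 * y10 ^ 3 * x48 * y22 - x4 ^ 3 * x8 ^ 2 * x48 * x54 * y22
      + x8 ^ 8 * y10 ^ 3 * x36 * y22 - x8 ^ 5 * x36 * x54 * y22
      - x8 ^ 2 * y10 ^ 3 * x36 * x48 * y22 + x4 ^ 3 * x8 ^ 7 * y10 * x54 * x20
      - x4 ^ 3 * x8 * y10 * x48 * x54 * x20 - x8 ^ 7 * y10 ^ 4 * x36 * x20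
      - x4 ^ 4 * x8 ^ 3 * y10 * x48 * x54 - x4 * x8 ^ 9 * y10 ^ 4 * x36
      - x4 * x8 ^ 3 * y10 ^ 4 * x36 * x48 := by
  obtain ⟨K, _, _, φ, hφ⟩ := exists_field_embedding
  have hx : φ x4 ≠ 0 := (map_ne_zero_iff φ hφ).2 x4_ne_zero
  obtain ⟨h26, h48, h54, h58, h60, h64, h76⟩ := map_generators φ hφ
  refine ⟨?_, ?_, ?_, ?_, ?_, ?_, ?_, ?_, ?_, ?_⟩ <;>
  · apply hφ
    simp only [map_add, map_sub, map_neg, map_mul, map_pow, h26, h48, h54, h58, h60, h64, h76]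
    clear h26 h48 h54 h58 h60 h64 h76
    field_simp
    grind

end

end WeylE6

/-! ### The algebra is spanned by the monomial basis -/

namespace WeylE6

noncomputable section

/-- The elements of `HBT` attached to the basis of the first summand of `C`. -/
def γ' : Fin 9 → HBT :=
  ![1, x20, x20 ^ 2, y22, y22 ^ 2, x20 * y22, y58, y60, y76]

/-- The elements of `HBT` attached to the basis of the second summand of `C`. -/
def δ' : Fin 5 → HBT := ![y26, y26 ^ 2, x20 * y26, y22 * y26, y64]

/-- Indices of the monomial basis of `C ⊗ Q`: a basis symbol of `C` together with the exponents of
its coefficient, and the exponents of a monomial in `x36, x48, x54`. -/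
abbrev Idx : Type :=
  ((Fin 9 × (Fin 3 →₀ ℕ)) ⊕ (Fin 5 × (Fin 2 →₀ ℕ))) × (Fin 3 →₀ ℕ)

/-- The coefficient monomial times the basis symbol, computed in `HBT`. -/
def vC : (Fin 9 × (Fin 3 →₀ ℕ)) ⊕ (Fin 5 × (Fin 2 →₀ ℕ)) → HBT
  | .inl (i, e) => x4 ^ e 0 * x8 ^ e 1 * y10 ^ e 2 * γ' i
  | .inr (j, e) => x8 ^ e 0 * y10 ^ e 1 * δ' j

/-- The value of `σ` on the monomial basis of `C ⊗ Q`, as an element of `HBT`. -/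
def v (k : Idx) : HBT := vC k.1 * (x36 ^ k.2 0 * x48 ^ k.2 1 * x54 ^ k.2 2)

/-- The subspace of `HBT` spanned by the values of `σ` on the monomial basis. -/
def N : Submodule (ZMod 3) HBT := Submodule.span (ZMod 3) (Set.range v)

/-- The subalgebra of all elements which multiply `N` into itself. -/
def stab : Subalgebra (ZMod 3) HBT where
  carrier := {f | ∀ n ∈ N, f * n ∈ N}
  mul_mem' {f g} hf hg n hn := by rw [mul_assoc]; exact hf _ (hg _ hn)
  one_mem' n hn := by rwa [one_mul]
  add_mem' {f g} hf hg n hn := by rw [add_mul]; exact add_mem (hf _ hn) (hg _ hn)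
  zero_mem' n _ := by rw [zero_mul]; exact zero_mem _
  algebraMap_mem' r n hn := by rw [← Algebra.smul_def]; exact N.smul_mem r hn

theorem mul_mem_N {f n : HBT} (hf : f ∈ stab) (hn : n ∈ N) : f * n ∈ N := hf n hn

theorem mem_stab_of_forall {f : HBT} (h : ∀ k, f * v k ∈ N) : f ∈ stab := fun n hn => by
  induction hn using Submodule.span_induction with
  | mem x hx => obtain ⟨k, rfl⟩ := hx; exact h k
  | zero => rw [mul_zero]; exact zero_mem _
  | add a b _ _ ha hb => rw [mul_add]; exact add_mem ha hb
  | smul r a _ ha => rw [mul_smul_comm]; exact N.smul_mem r ha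

theorem v_mem_N (k : Idx) : v k ∈ N := Submodule.subset_span ⟨k, rfl⟩

theorem γ'_mem_N (i : Fin 9) : γ' i ∈ N := by
  simpa [v, vC] using v_mem_N (.inl (i, 0), 0)

theorem δ'_mem_N (j : Fin 5) : δ' j ∈ N := by
  simpa [v, vC] using v_mem_N (.inr (j, 0), 0)

open Finsupp in
theorem x8_mem_stab : x8 ∈ stab := by
  refine mem_stab_of_forall ?_
  rintro ⟨⟨i, e⟩ | ⟨j, e⟩, J⟩
  · convert v_mem_N (.inl (i, e + single 1 1), J) using 1
    simp [v, vC]; ring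
  · convert v_mem_N (.inr (j, e + single 0 1), J) using 1
    simp [v, vC]; ring

open Finsupp in
theorem y10_mem_stab : y10 ∈ stab := by
  refine mem_stab_of_forall ?_
  rintro ⟨⟨i, e⟩ | ⟨j, e⟩, J⟩
  · convert v_mem_N (.inl (i, e + single 2 1), J) using 1
    simp [v, vC]; ring
  · convert v_mem_N (.inr (j, e + single 1 1), J) using 1
    simp [v, vC]; ring

open Finsupp in
theorem x36_mem_stab : x36 ∈ stab := by
  refine mem_stab_of_forall fun ⟨k, J⟩ => ?_
  convert v_mem_N (k, J + single 0 1) using 1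
  simp [v]; ring

open Finsupp in
theorem x48_mem_stab : x48 ∈ stab := by
  refine mem_stab_of_forall fun ⟨k, J⟩ => ?_
  convert v_mem_N (k, J + single 1 1) using 1
  simp [v]; ring

open Finsupp in
theorem x54_mem_stab : x54 ∈ stab := by
  refine mem_stab_of_forall fun ⟨k, J⟩ => ?_
  convert v_mem_N (k, J + single 2 1) using 1
  simp [v]; ring

theorem x4_mul_δ'_mem_N (j : Fin 5) : x4 * δ' j ∈ N := by
  obtain ⟨h1, h2, h3, h4, h5⟩ := x4_mul_relations
  have g := γ'_mem_N
  have d := δ'_mem_N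
  have h8 := x8_mem_stab
  have h10 := y10_mem_stab
  fin_cases j
  · change x4 * y26 ∈ N
    rw [h1]
    exact add_mem (mul_mem_N (neg_mem h8) (g 3)) (mul_mem_N h10 (g 1))
  · change x4 * y26 ^ 2 ∈ N
    rw [h2]
    exact add_mem (mul_mem_N (neg_mem h8) (d 3)) (mul_mem_N h10 (d 2))
  · change x4 * (x20 * y26) ∈ N
    rw [← mul_assoc, h3]
    exact add_mem (mul_mem_N (neg_mem h8) (g 5)) (mul_mem_N h10 (g 2))
  · change x4 * (y22 * y26) ∈ N
    rw [← mul_assoc, h4]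
    exact add_mem (mul_mem_N (neg_mem h8) (g 4)) (mul_mem_N h10 (g 5))
  · change x4 * y64 ∈ N
    rw [h5]
    exact sub_mem (sub_mem (mul_mem_N (neg_mem h8) (g 7)) (mul_mem_N h10 (g 6)))
      (mul_mem_N (pow_mem h8 3) (g 4))

open Finsupp in
/-- On the second summand, multiplication by `x4` leaves the monomial basis, since `x4` is not among
the coefficients there; the relations for `x4 * δ` bring the product back into the span. -/
theorem x4_mem_stab : x4 ∈ stab := by
  refine mem_stab_of_forall ?_
  rintro ⟨⟨i, e⟩ | ⟨j, e⟩, J⟩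
  · convert v_mem_N (.inl (i, e + single 0 1), J) using 1
    simp [v, vC]; ring
  · have hc : x8 ^ e 0 * y10 ^ e 1 * (x36 ^ J 0 * x48 ^ J 1 * x54 ^ J 2) ∈ stab :=
      mul_mem (mul_mem (pow_mem x8_mem_stab _) (pow_mem y10_mem_stab _))
        (mul_mem (mul_mem (pow_mem x36_mem_stab _) (pow_mem x48_mem_stab _))
          (pow_mem x54_mem_stab _))
    convert mul_mem_N hc (x4_mul_δ'_mem_N j) using 1
    simp only [v, vC]; ring

/-- An element stabilises `N` once it multiplies the fourteen basis symbols into `N`, because the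
coefficients `x4, x8, y10, x36, x48, x54` stabilise `N`. -/
theorem mem_stab_of_basis {f : HBT} (hγ : ∀ i, f * γ' i ∈ N) (hδ : ∀ j, f * δ' j ∈ N) :
    f ∈ stab := by
  refine mem_stab_of_forall ?_
  rintro ⟨⟨i, e⟩ | ⟨j, e⟩, J⟩
  · have hc : x4 ^ e 0 * x8 ^ e 1 * y10 ^ e 2 * (x36 ^ J 0 * x48 ^ J 1 * x54 ^ J 2) ∈ stab :=
      mul_mem (mul_mem (mul_mem (pow_mem x4_mem_stab _) (pow_mem x8_mem_stab _))
        (pow_mem y10_mem_stab _))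
        (mul_mem (mul_mem (pow_mem x36_mem_stab _) (pow_mem x48_mem_stab _))
          (pow_mem x54_mem_stab _))
    convert mul_mem_N hc (hγ i) using 1
    simp only [v, vC]; ring
  · have hc : x8 ^ e 0 * y10 ^ e 1 * (x36 ^ J 0 * x48 ^ J 1 * x54 ^ J 2) ∈ stab :=
      mul_mem (mul_mem (pow_mem x8_mem_stab _) (pow_mem y10_mem_stab _))
        (mul_mem (mul_mem (pow_mem x36_mem_stab _) (pow_mem x48_mem_stab _))
          (pow_mem x54_mem_stab _))
    convert mul_mem_N hc (hδ j) using 1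
    simp only [v, vC]; ring

set_option maxHeartbeats 2000000 in
/-- The products expanded in the relations lie in `N`: up to sign, every term of an expansion is the
product of a monomial in `x4, x8, y10, x36, x48, x54`, which stabilises `N`, and a basis symbol. -/
theorem relations_mem_N :
    (x20 * x20 * x20 ∈ N ∧ x20 * x20 * y22 ∈ N ∧ x20 * x20 * y26 ∈ N ∧ x20 * y22 * y22 ∈ N ∧
      x20 * y22 * y26 ∈ N ∧ x20 * y26 * y26 ∈ N ∧ y22 * y22 * y22 ∈ N ∧ y22 * y22 * y26 ∈ N ∧
      y22 * y26 * y26 ∈ N ∧ y26 * y26 * y26 ∈ N) ∧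
    (x20 * y58 ∈ N ∧ x20 * y60 ∈ N ∧ x20 * y64 ∈ N ∧ x20 * y76 ∈ N ∧
      y22 * y58 ∈ N ∧ y22 * y60 ∈ N ∧ y22 * y64 ∈ N ∧ y22 * y76 ∈ N ∧
      y26 * y58 ∈ N ∧ y26 * y60 ∈ N ∧ y26 * y64 ∈ N ∧ y26 * y76 ∈ N) ∧
    (y58 * y58 ∈ N ∧ y58 * y60 ∈ N ∧ y58 * y64 ∈ N ∧ y58 * y76 ∈ N ∧ y60 * y60 ∈ N ∧
      y60 * y64 ∈ N ∧ y60 * y76 ∈ N ∧ y64 * y64 ∈ N ∧ y64 * y76 ∈ N ∧ y76 * y76 ∈ N) := by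
  obtain ⟨c1, c2, c3, c4, c5, c6, c7, c8, c9, c10⟩ := cubic_relations
  obtain ⟨m1, m2, m3, m4, m5, m6, m7, m8, m9, m10, m11, m12⟩ := mixed_relations
  obtain ⟨h1, h2, h3, h4, h5, h6, h7, h8, h9, h10⟩ := high_relations
  rw [c1, c2, c3, c4, c5, c6, c7, c8, c9, c10, m1, m2, m3, m4, m5, m6, m7, m8, m9, m10, m11, m12,
    h1, h2, h3, h4, h5, h6, h7, h8, h9, h10]
  have e4 := x4_mem_stab
  have e8 := x8_mem_stab
  have e10 := y10_mem_stab
  have e36 := x36_mem_stab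
  have e48 := x48_mem_stab
  have e54 := x54_mem_stab
  have g0 : 1 ∈ N := γ'_mem_N 0
  have g1 : x20 ∈ N := γ'_mem_N 1
  have g2 : x20 ^ 2 ∈ N := γ'_mem_N 2
  have g3 : y22 ∈ N := γ'_mem_N 3
  have g4 : y22 ^ 2 ∈ N := γ'_mem_N 4
  have g5 : x20 * y22 ∈ N := γ'_mem_N 5
  have g6 : y58 ∈ N := γ'_mem_N 6
  have g7 : y60 ∈ N := γ'_mem_N 7
  have g8 : y76 ∈ N := γ'_mem_N 8
  have d0 : y26 ∈ N := δ'_mem_N 0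
  have d1 : y26 ^ 2 ∈ N := δ'_mem_N 1
  have d2 : x20 * y26 ∈ N := δ'_mem_N 2
  have d3 : y22 * y26 ∈ N := δ'_mem_N 3
  have d4 : y64 ∈ N := δ'_mem_N 4
  have g36 : x36 ∈ N := by simpa using e36 1 g0
  have g48 : x48 ∈ N := by simpa using e48 1 g0
  have g54 : x54 ∈ N := by simpa using e54 1 g0
  clear c1 c2 c3 c4 c5 c6 c7 c8 c9 c10 m1 m2 m3 m4 m5 m6 m7 m8 m9 m10 m11 m12
  clear h1 h2 h3 h4 h5 h6 h7 h8 h9 h10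
  repeat' first
    | with_reducible assumption
    | with_reducible apply And.intro
    | with_reducible apply mul_mem_N
    | with_reducible apply add_mem
    | with_reducible apply sub_mem
    | with_reducible apply neg_mem
    | with_reducible apply mul_mem
    | with_reducible apply pow_mem

theorem mem_stab_of_products {f : HBT} (h0 : f ∈ N) (h20 : x20 * f ∈ N) (h22 : y22 * f ∈ N)
    (h26 : y26 * f ∈ N) (h2020 : x20 * x20 * f ∈ N) (h2022 : x20 * y22 * f ∈ N)
    (h2026 : x20 * y26 * f ∈ N) (h2222 : y22 * y22 * f ∈ N) (h2226 : y22 * y26 * f ∈ N)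
    (h2626 : y26 * y26 * f ∈ N) (h58 : f * y58 ∈ N) (h60 : f * y60 ∈ N) (h64 : f * y64 ∈ N)
    (h76 : f * y76 ∈ N) : f ∈ stab := by
  refine mem_stab_of_basis (fun i => ?_) (fun j => ?_)
  · fin_cases i
    · change f * 1 ∈ N; rw [mul_one]; exact h0
    · change f * x20 ∈ N; rw [mul_comm]; exact h20
    · change f * x20 ^ 2 ∈ N; rw [mul_comm, pow_two]; exact h2020
    · change f * y22 ∈ N; rw [mul_comm]; exact h22
    · change f * y22 ^ 2 ∈ N; rw [mul_comm, pow_two]; exact h2222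
    · change f * (x20 * y22) ∈ N; rw [mul_comm]; exact h2022
    · exact h58
    · exact h60
    · exact h76
  · fin_cases j
    · change f * y26 ∈ N; rw [mul_comm]; exact h26
    · change f * y26 ^ 2 ∈ N; rw [mul_comm, pow_two]; exact h2626
    · change f * (x20 * y26) ∈ N; rw [mul_comm]; exact h2026
    · change f * (y22 * y26) ∈ N; rw [mul_comm]; exact h2226
    · exact h64

theorem x20_y22_y26_mem_stab : x20 ∈ stab ∧ y22 ∈ stab ∧ y26 ∈ stab := by
  obtain ⟨⟨c1, c2, c3, c4, c5, c6, c7, c8, c9, c10⟩,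
    ⟨m1, m2, m3, m4, m5, m6, m7, m8, m9, m10, m11, m12⟩, -⟩ := relations_mem_N
  have g1 : x20 ∈ N := γ'_mem_N 1
  have g2 : x20 * x20 ∈ N := pow_two x20 ▸ γ'_mem_N 2
  have g3 : y22 ∈ N := γ'_mem_N 3
  have g4 : y22 * y22 ∈ N := pow_two y22 ▸ γ'_mem_N 4
  have g5 : x20 * y22 ∈ N := γ'_mem_N 5
  have d0 : y26 ∈ N := δ'_mem_N 0
  have d1 : y26 * y26 ∈ N := pow_two y26 ▸ δ'_mem_N 1
  have d2 : x20 * y26 ∈ N := δ'_mem_N 2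
  have d3 : y22 * y26 ∈ N := δ'_mem_N 3
  refine ⟨mem_stab_of_products g1 g2 ?_ ?_ c1 ?_ ?_ ?_ ?_ ?_ m1 m2 m3 m4,
    mem_stab_of_products g3 g5 g4 ?_ c2 c4 ?_ c7 ?_ ?_ m5 m6 m7 m8,
    mem_stab_of_products d0 d2 d3 d1 c3 c5 c6 c8 c9 c10 m9 m10 m11 m12⟩
  · rw [mul_comm]; exact g5
  · rw [mul_comm]; exact d2
  · rw [mul_right_comm]; exact c2
  · rw [mul_right_comm]; exact c3
  · rw [mul_comm, ← mul_assoc]; exact c4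
  · rw [mul_comm, ← mul_assoc]; exact c5
  · rw [mul_comm, ← mul_assoc]; exact c6
  · rw [mul_comm]; exact d3
  · rw [mul_right_comm]; exact c5
  · rw [mul_right_comm]; exact c8
  · rw [mul_comm, ← mul_assoc]; exact c9

/-- The basis symbols other than `1, y58, y60, y64, y76` are products of `x20, y22, y26`, which
already stabilise `N`. -/
theorem mem_stab_of_high_products {f : HBT} (h0 : f ∈ N) (h58 : f * y58 ∈ N) (h60 : f * y60 ∈ N)
    (h64 : f * y64 ∈ N) (h76 : f * y76 ∈ N) : f ∈ stab := by
  obtain ⟨s20, s22, s26⟩ := x20_y22_y26_mem_stab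
  exact mem_stab_of_products h0 (s20 _ h0) (s22 _ h0) (s26 _ h0) (mul_mem s20 s20 _ h0)
    (mul_mem s20 s22 _ h0) (mul_mem s20 s26 _ h0) (mul_mem s22 s22 _ h0) (mul_mem s22 s26 _ h0)
    (mul_mem s26 s26 _ h0) h58 h60 h64 h76

theorem A_le_stab : A ≤ stab := by
  obtain ⟨s20, s22, s26⟩ := x20_y22_y26_mem_stab
  obtain ⟨-, -, h1, h2, h3, h4, h5, h6, h7, h8, h9, h10⟩ := relations_mem_N
  refine Algebra.adjoin_le ?_
  rintro _ ⟨g, rfl⟩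
  cases g
  · exact x4_mem_stab
  · exact x8_mem_stab
  · exact y10_mem_stab
  · exact s20
  · exact s22
  · exact s26
  · exact x36_mem_stab
  · exact x48_mem_stab
  · exact x54_mem_stab
  · exact mem_stab_of_high_products (γ'_mem_N 6) h1 h2 h3 h4
  · exact mem_stab_of_high_products (γ'_mem_N 7) (mul_comm y58 y60 ▸ h2) h5 h6 h7
  · exact mem_stab_of_high_products (δ'_mem_N 4) (mul_comm y58 y64 ▸ h3) (mul_comm y60 y64 ▸ h6)
      h8 h9
  · exact mem_stab_of_high_products (γ'_mem_N 8) (mul_comm y58 y76 ▸ h4) (mul_comm y60 y76 ▸ h7)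
      (mul_comm y64 y76 ▸ h9) h10

theorem coe_γ (i : Fin 9) : (γ i : HBT) = γ' i := by fin_cases i <;> rfl

theorem coe_δ (j : Fin 5) : (δ j : HBT) = δ' j := by fin_cases j <;> rfl

theorem v_mem_A (k : Idx) : v k ∈ A := by
  have h4 : x4 ∈ A := (a .x4).2
  have h8 : x8 ∈ A := (a .x8).2
  have h10 : y10 ∈ A := (a .y10).2
  have hJ : ∀ J : Fin 3 →₀ ℕ, x36 ^ J 0 * x48 ^ J 1 * x54 ^ J 2 ∈ A := fun J =>
    mul_mem (mul_mem (pow_mem (a .x36).2 _) (pow_mem (a .x48).2 _)) (pow_mem (a .x54).2 _)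
  obtain ⟨⟨i, e⟩ | ⟨j, e⟩, J⟩ := k
  · exact mul_mem (mul_mem (mul_mem (mul_mem (pow_mem h4 _) (pow_mem h8 _)) (pow_mem h10 _))
      (coe_γ i ▸ (γ i).2)) (hJ J)
  · exact mul_mem (mul_mem (mul_mem (pow_mem h8 _) (pow_mem h10 _)) (coe_δ j ▸ (δ j).2)) (hJ J)

theorem toSubmodule_A : Subalgebra.toSubmodule A = N := by
  apply le_antisymm
  · intro f hf
    simpa using A_le_stab hf 1 (γ'_mem_N 0)
  · exact Submodule.span_le.2 (by rintro _ ⟨k, rfl⟩; exact v_mem_A k)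

end

end WeylE6

/-! ### Weights and leading monomials -/

namespace WeylE6

noncomputable section

/-- Weights of the parameters `t, x4, x8, y10, h12, h16`. They are chosen so that every
generator has a single monomial of highest weight: `h18` starts with `t ^ 9` as `1 + 7 < 9`, the
term `h16 * x4` of `x20` dominates `h12 * x8` as `5 < 7`, and `h12 ^ 3` in `x36` dominates
`g24 * x4 ^ 3` as `12 < 15`. -/
def wt : Fin 6 → ℕ := ![1, 0, 0, 0, 5, 7]

/-- The weight of the monomial with exponents `e` in the parameters. -/
def weight (e : Fin 6 → ℕ) : ℕ := e 0 + 5 * e 4 + 7 * e 5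

/-- The monomial with exponents `e` and coefficient `c`. -/
def mono (e : Fin 6 → ℕ) (c : ZMod 3) : MvPolynomial (Fin 6) (ZMod 3) :=
  MvPolynomial.monomial (Finsupp.equivFunOnFinite.symm e) c

/-- The homomorphism `Xᵢ ↦ Xᵢ s ^ wt i`, where `s` is the polynomial variable of the target: it
records the weight of a polynomial in the parameters as the degree in `s`. -/
def scale : MvPolynomial (Fin 6) (ZMod 3) →ₐ[ZMod 3]
    Polynomial (MvPolynomial (Fin 6) (ZMod 3)) :=
  MvPolynomial.aeval fun i => Polynomial.C (MvPolynomial.X i) * Polynomial.X ^ wt i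

/-- Evaluation of a polynomial at the parameters `t, x4, x8, y10, h12, h16`. -/
abbrev ev : MvPolynomial (Fin 6) (ZMod 3) →ₐ[ZMod 3] HBT := MvPolynomial.aeval param

theorem ev_injective : Function.Injective ev := algebraicIndependent_param

/-- `f` is a polynomial of weight at most `n` in the parameters. -/
def WeightLE (f : HBT) (n : ℕ) : Prop := ∃ q, ev q = f ∧ (scale q).natDegree ≤ n

/-- `f` is a polynomial in the parameters whose part of highest weight is, up to a nonzero scalar,
the monomial with exponents `e`. -/
def HasLead (f : HBT) (e : Fin 6 → ℕ) : Prop :=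
  ∃ q c, ev q = f ∧ c ≠ 0 ∧ (scale q).natDegree = weight e ∧ (scale q).leadingCoeff = mono e c

theorem weight_add (e e' : Fin 6 → ℕ) : weight (e + e') = weight e + weight e' := by
  simp [weight]; ring

theorem mono_mul (e e' : Fin 6 → ℕ) (c c' : ZMod 3) :
    mono e c * mono e' c' = mono (e + e') (c * c') := by
  have : Finsupp.equivFunOnFinite.symm e + Finsupp.equivFunOnFinite.symm e' =
      Finsupp.equivFunOnFinite.symm (e + e') := by ext; simp
  rw [mono, mono, MvPolynomial.monomial_mul, this, mono]

theorem mono_ne_zero {e : Fin 6 → ℕ} {c : ZMod 3} (hc : c ≠ 0) : mono e c ≠ 0 := by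
  simpa [mono] using hc

namespace WeightLE

variable {f g : HBT} {m n : ℕ}

theorem mono (hf : WeightLE f m) (h : m ≤ n) : WeightLE f n :=
  let ⟨q, hq, hd⟩ := hf
  ⟨q, hq, hd.trans h⟩

theorem add (hf : WeightLE f n) (hg : WeightLE g n) : WeightLE (f + g) n :=
  let ⟨q, hq, hd⟩ := hf
  let ⟨r, hr, hd'⟩ := hg
  ⟨q + r, by rw [map_add, hq, hr], by
    rw [map_add]; exact Polynomial.natDegree_add_le_of_degree_le hd hd'⟩

theorem neg (hf : WeightLE f n) : WeightLE (-f) n :=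
  let ⟨q, hq, hd⟩ := hf
  ⟨-q, by rw [map_neg, hq], by rwa [map_neg, Polynomial.natDegree_neg]⟩

theorem sub (hf : WeightLE f n) (hg : WeightLE g n) : WeightLE (f - g) n := by
  rw [sub_eq_add_neg]; exact hf.add hg.neg

theorem mul (hf : WeightLE f m) (hg : WeightLE g n) : WeightLE (f * g) (m + n) :=
  let ⟨q, hq, hd⟩ := hf
  let ⟨r, hr, hd'⟩ := hg
  ⟨q * r, by rw [map_mul, hq, hr], by
    rw [map_mul]; exact Polynomial.natDegree_mul_le_of_le hd hd'⟩

theorem pow (hf : WeightLE f n) (k : ℕ) : WeightLE (f ^ k) (k * n) :=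
  let ⟨q, hq, hd⟩ := hf
  ⟨q ^ k, by rw [map_pow, hq], by
    rw [map_pow]; exact Polynomial.natDegree_pow_le_of_le k hd⟩

theorem mem_range (hf : WeightLE f n) : f ∈ ev.range :=
  let ⟨q, hq, _⟩ := hf
  ⟨q, hq⟩

end WeightLE

namespace HasLead

variable {f g : HBT} {e e' : Fin 6 → ℕ} {n : ℕ}

theorem weightLE (hf : HasLead f e) : WeightLE f (weight e) :=
  let ⟨q, _, hq, _, hd, _⟩ := hf
  ⟨q, hq, hd.le⟩

theorem neg (hf : HasLead f e) : HasLead (-f) e := by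
  obtain ⟨q, c, hq, hc, hd, hl⟩ := hf
  refine ⟨-q, -c, by rw [map_neg, hq], neg_ne_zero.2 hc, by rwa [map_neg, Polynomial.natDegree_neg],
    ?_⟩
  rw [map_neg, Polynomial.leadingCoeff_neg, hl, mono, mono, map_neg]

theorem mul (hf : HasLead f e) (hg : HasLead g e') : HasLead (f * g) (e + e') := by
  obtain ⟨q, c, hq, hc, hd, hl⟩ := hf
  obtain ⟨r, c', hr, hc', hd', hl'⟩ := hg
  have hq0 : scale q ≠ 0 := by
    rw [← Polynomial.leadingCoeff_ne_zero, hl]; exact mono_ne_zero hc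
  have hr0 : scale r ≠ 0 := by
    rw [← Polynomial.leadingCoeff_ne_zero, hl']; exact mono_ne_zero hc'
  refine ⟨q * r, c * c', by rw [map_mul, hq, hr], mul_ne_zero hc hc', ?_, ?_⟩
  · rw [map_mul, Polynomial.natDegree_mul hq0 hr0, hd, hd', weight_add]
  · rw [map_mul, Polynomial.leadingCoeff_mul, hl, hl', mono_mul]

theorem one : HasLead 1 0 :=
  ⟨1, 1, map_one _, one_ne_zero, by simp [weight], by
    have : Finsupp.equivFunOnFinite.symm (0 : Fin 6 → ℕ) = 0 := by ext; simp
    rw [map_one, Polynomial.leadingCoeff_one, mono, this]; rfl⟩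

theorem pow (hf : HasLead f e) (k : ℕ) : HasLead (f ^ k) (k • e) := by
  induction k with
  | zero => simpa using one
  | succ k ih => rw [pow_succ, succ_nsmul]; exact ih.mul hf

theorem add (hf : HasLead f e) (hg : WeightLE g n) (h : n < weight e) : HasLead (f + g) e := by
  obtain ⟨q, c, hq, hc, hd, hl⟩ := hf
  obtain ⟨r, hr, hd'⟩ := hg
  have hlt : (scale r).natDegree < (scale q).natDegree := by omega
  refine ⟨q + r, c, by rw [map_add, hq, hr], hc, ?_, ?_⟩
  · rw [map_add, Polynomial.natDegree_add_eq_left_of_natDegree_lt hlt, hd]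
  · rw [map_add, Polynomial.leadingCoeff_add_of_degree_lt' (Polynomial.degree_lt_degree hlt), hl]

theorem add_right (hf : WeightLE f n) (hg : HasLead g e) (h : n < weight e) :
    HasLead (f + g) e := by
  rw [add_comm]; exact hg.add hf h

theorem sub (hf : HasLead f e) (hg : WeightLE g n) (h : n < weight e) : HasLead (f - g) e := by
  rw [sub_eq_add_neg]; exact hf.add hg.neg h

theorem sub_right (hf : WeightLE f n) (hg : HasLead g e) (h : n < weight e) :
    HasLead (f - g) e := by
  rw [sub_eq_add_neg]; exact add_right hf hg.neg h

/-- Leading monomials can be divided: this determines the leading monomial of a quotient. -/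
theorem of_mul (hfg : HasLead (f * g) (e + e')) (hf : HasLead f e) (hg : g ∈ ev.range) :
    HasLead g e' := by
  obtain ⟨q, c, hq, hc, hd, hl⟩ := hf
  obtain ⟨r, hr⟩ := hg
  obtain ⟨u, c', hu, hc', hd', hl'⟩ := hfg
  have hur : u = q * r := ev_injective (by rw [map_mul, hq, hu]; exact congrArg _ hr.symm)
  subst hur
  have h0 : scale (q * r) ≠ 0 := by
    rw [← Polynomial.leadingCoeff_ne_zero, hl']; exact mono_ne_zero hc'
  rw [map_mul] at h0 hd' hl'
  rw [Polynomial.natDegree_mul (left_ne_zero_of_mul h0) (right_ne_zero_of_mul h0), hd,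
    weight_add] at hd'
  refine ⟨r, c⁻¹ * c', hr, mul_ne_zero (inv_ne_zero hc) hc', by omega, ?_⟩
  apply mul_left_cancel₀ (mono_ne_zero (e := e) hc)
  rw [mono_mul, mul_inv_cancel_left₀ hc, ← hl', Polynomial.leadingCoeff_mul, hl]

theorem congr (hf : HasLead f e) (h : f = g) (h' : e = e') : HasLead g e' := h ▸ h' ▸ hf

theorem param (i : Fin 6) : HasLead (param i) (Pi.single i 1) := by
  refine ⟨MvPolynomial.X i, 1, by simp, one_ne_zero, ?_, ?_⟩
  · rw [scale, MvPolynomial.aeval_X,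
      Polynomial.natDegree_C_mul_X_pow _ _ (MvPolynomial.X_ne_zero i)]
    fin_cases i <;> simp [wt, weight]
  · rw [scale, MvPolynomial.aeval_X, Polynomial.leadingCoeff_C_mul_X_pow, mono, MvPolynomial.X]
    congr 1
    ext j
    simp

end HasLead

/-- A family of polynomials with linearly independent leading coefficients is linearly
independent. -/
theorem linearIndependent_of_leadingCoeff {ι K R : Type*} [Field K] [CommRing R] [Algebra K R]
    (f : ι → Polynomial R) (h : LinearIndependent K fun i => (f i).leadingCoeff) :
    LinearIndependent K f := by
  classical
  rw [linearIndependent_iff'] at h ⊢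
  intro s g hg
  by_contra! hne
  obtain ⟨i₀, hi₀, hgi₀⟩ := hne
  obtain ⟨i, hi, hmax⟩ := (s.filter fun i => g i ≠ 0).exists_max_image (fun i => (f i).natDegree)
    ⟨i₀, by simp [hi₀, hgi₀]⟩
  rw [Finset.mem_filter] at hi
  have hc := congrArg (fun p => Polynomial.coeff p (f i).natDegree) hg
  simp only [Polynomial.finsetSum_coeff, Polynomial.coeff_smul, Polynomial.coeff_zero] at hc
  -- The coefficients in the highest degree give a relation between leading coefficients.
  have := h s (fun j => if (f j).natDegree = (f i).natDegree then g j else 0) (by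
    rw [← hc]
    refine Finset.sum_congr rfl fun j hj => ?_
    by_cases hgj : g j = 0
    · simp [hgj]
    split_ifs with hd
    · rw [← hd]; rfl
    · have hle := hmax j (by simp [hj, hgj])
      rw [Polynomial.coeff_eq_zero_of_natDegree_lt (by omega), smul_zero, zero_smul]) i hi.1
  simp [hi.2] at this

/-- Elements with distinct leading monomials are linearly independent. -/
theorem linearIndependent_of_hasLead {ι : Type*} (f : ι → HBT) (e : ι → Fin 6 → ℕ)
    (he : Function.Injective e) (hf : ∀ i, HasLead (f i) (e i)) : LinearIndependent (ZMod 3) f := by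
  choose q c hq hc hd hl using hf
  have h1 : LinearIndependent (ZMod 3) fun i => (scale (q i)).leadingCoeff := by
    have hb := (MvPolynomial.basisMonomials (Fin 6) (ZMod 3)).linearIndependent.comp
      (fun i => Finsupp.equivFunOnFinite.symm (e i))
      (Finsupp.equivFunOnFinite.symm.injective.comp he)
    have := hb.units_smul fun i => Units.mk0 (c i) (hc i)
    have hfun : (fun i => (scale (q i)).leadingCoeff) =
        (fun i => Units.mk0 (c i) (hc i)) • (MvPolynomial.basisMonomials (Fin 6) (ZMod 3)) ∘
          fun i => Finsupp.equivFunOnFinite.symm (e i) := by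
      ext1 i
      rw [hl i]
      simp [mono, MvPolynomial.smul_monomial, Units.smul_def]
    rw [hfun]
    exact this
  have h2 := linearIndependent_of_leadingCoeff (fun i => scale (q i)) h1
  have h3 : LinearIndependent (ZMod 3) q := h2.of_comp scale.toLinearMap
  have h4 := h3.map' ev.toLinearMap (LinearMap.ker_eq_bot.2 ev_injective)
  rwa [show f = ev.toLinearMap ∘ q from funext fun i => (hq i).symm]

end

end WeylE6

/-! ### Leading monomials of the generators and linear independence -/

namespace WeylE6

noncomputable section

theorem hasLead_t : HasLead t ![1, 0, 0, 0, 0, 0] := (HasLead.param 0).congr rfl (by decide)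

theorem hasLead_x4 : HasLead x4 ![0, 1, 0, 0, 0, 0] := (HasLead.param 1).congr rfl (by decide)

theorem hasLead_x8 : HasLead x8 ![0, 0, 1, 0, 0, 0] := (HasLead.param 2).congr rfl (by decide)

theorem hasLead_y10 : HasLead y10 ![0, 0, 0, 1, 0, 0] := (HasLead.param 3).congr rfl (by decide)

theorem hasLead_h12 : HasLead h12 ![0, 0, 0, 0, 1, 0] := (HasLead.param 4).congr rfl (by decide)

theorem hasLead_h16 : HasLead h16 ![0, 0, 0, 0, 0, 1] := (HasLead.param 5).congr rfl (by decide)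

/-- All terms of `h18` other than `t ^ 9` have weight at most `8`. -/
theorem hasLead_h18 : HasLead h18 ![9, 0, 0, 0, 0, 0] := by
  have ht : WeightLE t 1 := hasLead_t.weightLE
  have h4 : WeightLE x4 0 := hasLead_x4.weightLE
  have h8 : WeightLE x8 0 := hasLead_x8.weightLE
  have h12 : WeightLE h12 5 := hasLead_h12.weightLE
  have h16 : WeightLE h16 7 := hasLead_h16.weightLE
  have hlow : WeightLE (t * (WeylE6.h16 - x8 ^ 2) + t ^ 3 * (-WeylE6.h12 + x4 * x8) + t ^ 5 * x8
      - t ^ 7 * x4) 8 :=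
    (((ht.mul (h16.sub ((h8.pow 2).mono (by norm_num)))).add
      ((ht.pow 3).mul (h12.neg.add ((h4.mul h8).mono (by norm_num))))).add
      (((ht.pow 5).mul h8).mono (by norm_num))).sub (((ht.pow 7).mul h4).mono (by norm_num))
  exact (HasLead.add_right hlow (hasLead_t.pow 9) (by decide)).congr rfl (by decide)

theorem hasLead_x20 : HasLead x20 ![0, 1, 0, 0, 0, 1] :=
  (HasLead.add_right (hasLead_h12.mul hasLead_x8).weightLE (hasLead_h16.mul hasLead_x4)
    (by decide)).congr rfl (by decide)

theorem hasLead_y22 : HasLead y22 ![9, 1, 0, 0, 0, 0] :=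
  (HasLead.sub_right (hasLead_h12.mul hasLead_y10).weightLE (hasLead_h18.mul hasLead_x4)
    (by decide)).congr rfl (by decide)

theorem weightLE_g24 : WeightLE g24 12 := by
  have ht : WeightLE t 1 := hasLead_t.weightLE
  have h4 : WeightLE x4 0 := hasLead_x4.weightLE
  have h8 : WeightLE x8 0 := hasLead_x8.weightLE
  have h10 : WeightLE y10 0 := hasLead_y10.weightLE
  have h18 : WeightLE h18 9 := hasLead_h18.weightLE
  have h20 : WeightLE x20 7 := hasLead_x20.weightLE
  have h22 : WeightLE y22 9 := hasLead_y22.weightLE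
  unfold g24
  refine (((((((((((((((ht.pow 8).neg.mul h8).mono ?_).add (((ht.pow 7).mul h10).mono ?_)).sub
    (((ht.pow 6).mul (h4.pow 3)).mono ?_)).add ((((ht.pow 6).mul h4).mul h8).mono ?_)).add
    ((((ht.pow 4).mul (h4.pow 2)).mul h8).mono ?_)).sub
    (((ht.pow 4).mul (h8.pow 2)).mono ?_)).add (((ht.pow 3).mul h18).mono ?_)).add
    ((((ht.pow 3).mul (h4.pow 2)).mul h10).mono ?_)).sub
    ((((ht.pow 3).mul h8).mul h10).mono ?_)).add (((ht.pow 2).mul h20).mono ?_)).sub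
    (((ht.pow 2).mul (h10.pow 2)).mono ?_)).sub ((ht.mul h22).mono ?_)).sub
    ((((ht.mul h4).mul h8).mul h10).mono ?_)) <;> norm_num

theorem hasLead_x36 : HasLead x36 ![0, 0, 0, 0, 3, 0] := by
  have h4 : WeightLE x4 0 := hasLead_x4.weightLE
  have h8 : WeightLE x8 0 := hasLead_x8.weightLE
  have h12 : WeightLE h12 5 := hasLead_h12.weightLE
  have h20 : WeightLE x20 7 := hasLead_x20.weightLE
  have := ((((HasLead.add_right (weightLE_g24.neg.mul (h4.pow 3)) (hasLead_h12.pow 3)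
    (by decide)).sub (((h12.pow 2).mul h4).mul h8) (by decide)).sub ((h12.mul h20).mul h4)
    (by decide)).add ((h12.mul (h4.pow 2)).mul (h8.pow 2)) (by decide))
  exact this.congr rfl (by decide)

/-- The generators are polynomials in the parameters. -/
theorem generators_mem_range : y26 ∈ ev.range ∧ x48 ∈ ev.range ∧ x54 ∈ ev.range ∧
    y58 ∈ ev.range ∧ y60 ∈ ev.range ∧ y64 ∈ ev.range ∧ y76 ∈ ev.range := by
  have h4 := hasLead_x4.weightLE.mem_range
  have h8 := hasLead_x8.weightLE.mem_range
  have h10 := hasLead_y10.weightLE.mem_range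
  have h16 := hasLead_h16.weightLE.mem_range
  have h18 := hasLead_h18.weightLE.mem_range
  have h20 := hasLead_x20.weightLE.mem_range
  have h22 := hasLead_y22.weightLE.mem_range
  have h24 := weightLE_g24.mem_range
  have h26 : y26 ∈ ev.range := add_mem (mul_mem h16 h10) (mul_mem h18 h8)
  refine ⟨h26, ?_⟩
  rw [x48, x54, y58, y60, y64, y76]
  repeat' first
    | with_reducible assumption
    | with_reducible apply And.intro
    | with_reducible apply add_mem
    | with_reducible apply sub_mem
    | with_reducible apply neg_mem
    | with_reducible apply mul_mem
    | with_reducible apply pow_mem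

theorem hasLead_y26 : HasLead y26 ![9, 0, 1, 0, 0, 0] :=
  HasLead.of_mul ((HasLead.sub_right (hasLead_x20.mul hasLead_y10).weightLE
    (hasLead_y22.mul hasLead_x8) (by decide)).congr x4_mul_y26.symm (by decide)) hasLead_x4
    generators_mem_range.1

theorem hasLead_x48 : HasLead x48 ![0, 0, 0, 0, 0, 3] := by
  have h4 : WeightLE x4 0 := hasLead_x4.weightLE
  have h8 : WeightLE x8 0 := hasLead_x8.weightLE
  have h20 : WeightLE x20 7 := hasLead_x20.weightLE
  exact HasLead.of_mul ((((HasLead.add_right (hasLead_x36.weightLE.neg.mul (h8.pow 3))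
      (hasLead_x20.pow 3) (by decide)).add (((h20.pow 2).mul h4).mul (h8.pow 2)) (by decide)).add
      ((h20.mul (h4.pow 2)).mul (h8.pow 4)) (by decide)).congr
    x4_pow_mul_x48.symm (by decide)) (hasLead_x4.pow 3) generators_mem_range.2.1

theorem hasLead_x54 : HasLead x54 ![27, 0, 0, 0, 0, 0] := by
  have h4 : WeightLE x4 0 := hasLead_x4.weightLE
  have h8 : WeightLE x8 0 := hasLead_x8.weightLE
  have h10 : WeightLE y10 0 := hasLead_y10.weightLE
  have h20 : WeightLE x20 7 := hasLead_x20.weightLE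
  have h22 : WeightLE y22 9 := hasLead_y22.weightLE
  exact HasLead.of_mul (((((HasLead.sub_right (hasLead_x36.weightLE.mul (h10.pow 3))
      (hasLead_y22.pow 3) (by decide)).add (((h20.mul h22).mul h4).mul (h10.pow 2)) (by decide)).add
      ((((h22.pow 2).mul h4).mul h8).mul h10) (by decide)).sub
      (((h22.mul (h4.pow 2)).mul (h8.pow 2)).mul (h10.pow 2)) (by decide)).congr
    x4_pow_mul_x54.symm (by decide)) (hasLead_x4.pow 3) generators_mem_range.2.2.1

theorem hasLead_y58 : HasLead y58 ![9, 2, 0, 0, 0, 2] :=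
  HasLead.of_mul ((HasLead.sub_right
      ((hasLead_x36.mul (hasLead_x8.pow 2)).mul hasLead_y10).weightLE
      ((hasLead_x20.pow 2).mul hasLead_y22) (by decide)).congr
    x4_mul_y58.symm (by decide)) hasLead_x4 generators_mem_range.2.2.2.1

theorem hasLead_y60 : HasLead y60 ![18, 2, 0, 0, 0, 1] :=
  HasLead.of_mul ((HasLead.sub_right
      ((hasLead_x36.mul hasLead_x8).mul (hasLead_y10.pow 2)).weightLE
      (hasLead_x20.mul (hasLead_y22.pow 2)) (by decide)).congr
    x4_mul_y60.symm (by decide)) hasLead_x4 generators_mem_range.2.2.2.2.1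

theorem hasLead_y64 : HasLead y64 ![18, 1, 1, 0, 0, 1] :=
  HasLead.of_mul (((HasLead.sub_right (hasLead_y58.mul hasLead_y10).weightLE
      ((hasLead_x20.mul hasLead_y22).mul hasLead_y26) (by decide)).sub
      ((hasLead_y22.pow 2).mul (hasLead_x8.pow 3)).weightLE (by decide)).congr
    x4_mul_y64.symm (by decide)) hasLead_x4 generators_mem_range.2.2.2.2.2.1

theorem hasLead_y76 : HasLead y76 ![18, 2, 0, 0, 0, 2] := by
  -- In `x4 * y76 = y58 * y22 + y60 * x20 + …` both products have the same leading monomial;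
  -- the expansion of `x20 * y60` has a single product of highest weight.
  have h : x4 * y76 = x8 ^ 3 * y10 ^ 2 * x36 - x8 * y10 * x36 * y26 - x4 * x8 ^ 2 * y60
      - x20 * y60 := by
    linear_combination mixed_relations.2.1
  exact HasLead.of_mul ((HasLead.sub_right (n := 25)
      (((((((hasLead_x8.pow 3).mul (hasLead_y10.pow 2)).mul hasLead_x36).weightLE.mono
      (by decide)).sub ((((hasLead_x8.mul hasLead_y10).mul hasLead_x36).mul
      hasLead_y26).weightLE.mono (by decide))).sub
      (((hasLead_x4.mul (hasLead_x8.pow 2)).mul hasLead_y60).weightLE.mono (by decide))))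
      (hasLead_x20.mul hasLead_y60) (by decide)).congr
    h.symm (by decide)) hasLead_x4 generators_mem_range.2.2.2.2.2.2

/-- Exponents of the leading monomials of the basis symbols of the first summand of `C`. -/
def leadγ : Fin 9 → Fin 6 → ℕ :=
  ![0, ![0, 1, 0, 0, 0, 1], ![0, 2, 0, 0, 0, 2], ![9, 1, 0, 0, 0, 0], ![18, 2, 0, 0, 0, 0],
    ![9, 2, 0, 0, 0, 1], ![9, 2, 0, 0, 0, 2], ![18, 2, 0, 0, 0, 1], ![18, 2, 0, 0, 0, 2]]

/-- Exponents of the leading monomials of the basis symbols of the second summand of `C`. -/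
def leadδ : Fin 5 → Fin 6 → ℕ :=
  ![![9, 0, 1, 0, 0, 0], ![18, 0, 2, 0, 0, 0], ![9, 1, 1, 0, 0, 1], ![18, 1, 1, 0, 0, 0],
    ![18, 1, 1, 0, 0, 1]]

/-- Exponents of the leading monomials of the products `v k`. -/
def leadV : Idx → Fin 6 → ℕ
  | (.inl (i, e), J) => leadγ i + ![27 * J 2, e 0, e 1, e 2, 3 * J 0, 3 * J 1]
  | (.inr (j, e), J) => leadδ j + ![27 * J 2, 0, e 0, e 1, 3 * J 0, 3 * J 1]

theorem hasLead_γ' (i : Fin 9) : HasLead (γ' i) (leadγ i) := by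
  fin_cases i
  · exact HasLead.one
  · exact hasLead_x20
  · exact (hasLead_x20.pow 2).congr rfl (by decide)
  · exact hasLead_y22
  · exact (hasLead_y22.pow 2).congr rfl (by decide)
  · exact (hasLead_x20.mul hasLead_y22).congr rfl (by decide)
  · exact hasLead_y58
  · exact hasLead_y60
  · exact hasLead_y76

theorem hasLead_δ' (j : Fin 5) : HasLead (δ' j) (leadδ j) := by
  fin_cases j
  · exact hasLead_y26
  · exact (hasLead_y26.pow 2).congr rfl (by decide)
  · exact (hasLead_x20.mul hasLead_y26).congr rfl (by decide)
  · exact (hasLead_y22.mul hasLead_y26).congr rfl (by decide)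
  · exact hasLead_y64

theorem hasLead_v (k : Idx) : HasLead (v k) (leadV k) := by
  obtain ⟨⟨i, e⟩ | ⟨j, e⟩, J⟩ := k
  · refine ((((hasLead_x4.pow (e 0)).mul (hasLead_x8.pow (e 1))).mul (hasLead_y10.pow (e 2))).mul
      (hasLead_γ' i)).mul (((hasLead_x36.pow (J 0)).mul (hasLead_x48.pow (J 1))).mul
        (hasLead_x54.pow (J 2))) |>.congr rfl ?_
    ext l
    fin_cases l <;> simp [leadV, Matrix.vecHead, Matrix.vecTail] <;> omega
  · refine (((hasLead_x8.pow (e 0)).mul (hasLead_y10.pow (e 1))).mul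
      (hasLead_δ' j)).mul (((hasLead_x36.pow (J 0)).mul (hasLead_x48.pow (J 1))).mul
        (hasLead_x54.pow (J 2))) |>.congr rfl ?_
    ext l
    fin_cases l <;> simp [leadV, Matrix.vecHead, Matrix.vecTail] <;> omega

theorem leadγ_inj : ∀ i i' : Fin 9, leadγ i 0 % 27 = leadγ i' 0 % 27 →
    leadγ i 5 % 3 = leadγ i' 5 % 3 → i = i' := by decide

theorem leadδ_inj : ∀ j j' : Fin 5, leadδ j 0 % 27 = leadδ j' 0 % 27 → leadδ j 1 = leadδ j' 1 →
    leadδ j 5 % 3 = leadδ j' 5 % 3 → j = j' := by decide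

/-- A basis symbol of the second summand whose leading monomial agrees with one of the first summand
up to the contribution of the coefficients has a smaller exponent of `x4`; since `x4` does not occur
in the coefficients of the second summand, the two never give the same monomial. -/
theorem leadδ_lt_leadγ : ∀ (i : Fin 9) (j : Fin 5), leadγ i 0 % 27 = leadδ j 0 % 27 →
    leadγ i 5 % 3 = leadδ j 5 % 3 → leadδ j 1 < leadγ i 1 := by decide

/-- The exponents of `t` modulo `27` and of `h16` modulo `3` depend on the basis symbol only. They
determine it in the first summand, and together with the exponent of `x4` in the second one; the
remaining exponents then give the coefficient monomials. -/
theorem leadV_injective : Function.Injective leadV := by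
  rintro ⟨⟨i, e⟩ | ⟨j, e⟩, J⟩ ⟨⟨i', e'⟩ | ⟨j', e'⟩, J'⟩ h
  all_goals
    have h0 := congrFun h 0
    have h1 := congrFun h 1
    have h2 := congrFun h 2
    have h3 := congrFun h 3
    have h4 := congrFun h 4
    have h5 := congrFun h 5
    simp only [leadV, Pi.add_apply, Matrix.cons_val] at h0 h1 h2 h3 h4 h5
  · obtain rfl := leadγ_inj i i' (by omega) (by omega)
    have he : e = e' := by ext l; fin_cases l <;> simp <;> omega
    have hJ : J = J' := by ext l; fin_cases l <;> simp <;> omega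
    rw [he, hJ]
  · have := leadδ_lt_leadγ i j' (by omega) (by omega)
    omega
  · have := leadδ_lt_leadγ i' j (by omega) (by omega)
    omega
  · obtain rfl := leadδ_inj j j' (by omega) (by omega) (by omega)
    have he : e = e' := by ext l; fin_cases l <;> simp <;> omega
    have hJ : J = J' := by ext l; fin_cases l <;> simp <;> omega
    rw [he, hJ]

theorem linearIndependent_v : LinearIndependent (ZMod 3) v :=
  linearIndependent_of_hasLead v leadV leadV_injective hasLead_v

end

end WeylE6

/-! ### Grading and Poincaré series -/

namespace WeylE6

noncomputable section

theorem mul_mem_degreePart {f g : HBT} {m n k : ℕ} (hf : f ∈ degreePart m)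
    (hg : g ∈ degreePart n) (h : m + n = k) : f * g ∈ degreePart k :=
  h ▸ MvPolynomial.IsWeightedHomogeneous.mul hf hg

theorem pow_mem_degreePart {f : HBT} {m n k : ℕ} (hf : f ∈ degreePart m) (h : n * m = k) :
    f ^ n ∈ degreePart k :=
  h ▸ MvPolynomial.IsWeightedHomogeneous.pow hf n

theorem one_mem_degreePart : (1 : HBT) ∈ degreePart 0 :=
  MvPolynomial.isWeightedHomogeneous_one _ _

theorem ti_mem_degreePart (i : Fin 5) : ti i ∈ degreePart 2 :=
  MvPolynomial.isWeightedHomogeneous_X _ _ _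

theorem t_mem_degreePart : t ∈ degreePart 2 :=
  MvPolynomial.isWeightedHomogeneous_X _ _ _

/-- Elementary symmetric functions of homogeneous elements of the same degree are homogeneous. -/
theorem aeval_esymm_mem_degreePart (f : Fin 5 → HBT) (d k : ℕ) (hf : ∀ i, f i ∈ degreePart d) :
    MvPolynomial.aeval f (MvPolynomial.esymm (Fin 5) (ZMod 3) k) ∈ degreePart (k * d) := by
  rw [MvPolynomial.esymm, map_sum]
  refine Submodule.sum_mem _ fun s hs => ?_
  rw [map_prod]
  have := MvPolynomial.IsWeightedHomogeneous.prod s (fun i => f i) (fun _ => d) fun i _ => hf i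
  rw [Finset.sum_const, (Finset.mem_powersetCard.1 hs).2, smul_eq_mul] at this
  simp only [MvPolynomial.aeval_X]
  exact this

theorem p_mem_degreePart (k : ℕ) : p k ∈ degreePart (k * 4) :=
  aeval_esymm_mem_degreePart _ 4 k fun i => pow_mem_degreePart (ti_mem_degreePart i) rfl

theorem c_mem_degreePart (k : ℕ) : c k ∈ degreePart (k * 2) :=
  aeval_esymm_mem_degreePart _ 2 k ti_mem_degreePart

set_option maxHeartbeats 1000000 in
theorem generators_mem_degreePart :
    x4 ∈ degreePart 4 ∧ x8 ∈ degreePart 8 ∧ y10 ∈ degreePart 10 ∧ x20 ∈ degreePart 20 ∧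
    y22 ∈ degreePart 22 ∧ y26 ∈ degreePart 26 ∧ x36 ∈ degreePart 36 ∧ x48 ∈ degreePart 48 ∧
    x54 ∈ degreePart 54 ∧ y58 ∈ degreePart 58 ∧ y60 ∈ degreePart 60 ∧ y64 ∈ degreePart 64 ∧
    y76 ∈ degreePart 76 := by
  have ht := t_mem_degreePart
  have hp1 : p 1 ∈ degreePart 4 := p_mem_degreePart 1
  have hp2 : p 2 ∈ degreePart 8 := p_mem_degreePart 2
  have hp3 : p 3 ∈ degreePart 12 := p_mem_degreePart 3
  have hp4 : p 4 ∈ degreePart 16 := p_mem_degreePart 4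
  have hc5 : c 5 ∈ degreePart 10 := c_mem_degreePart 5
  have h4 : x4 ∈ degreePart 4 := hp1
  have h8 : x8 ∈ degreePart 8 := sub_mem hp2 (pow_mem_degreePart hp1 rfl)
  have h10 : y10 ∈ degreePart 10 := sub_mem (sub_mem hc5 (mul_mem_degreePart ht h8 rfl))
    (mul_mem_degreePart (pow_mem_degreePart ht rfl) h4 rfl)
  have h12 : h12 ∈ degreePart 12 := sub_mem (sub_mem (add_mem hp3 (mul_mem_degreePart ht h10 rfl))
    (mul_mem_degreePart (pow_mem_degreePart ht rfl) h8 rfl))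
    (mul_mem_degreePart (pow_mem_degreePart ht rfl) h4 rfl)
  have h16 : h16 ∈ degreePart 16 := sub_mem (sub_mem (add_mem hp4
    (mul_mem_degreePart (pow_mem_degreePart ht rfl) h10 rfl))
    (mul_mem_degreePart (pow_mem_degreePart ht rfl) h8 rfl))
    (mul_mem_degreePart (pow_mem_degreePart ht rfl) h4 rfl)
  have h18 : h18 ∈ degreePart 18 := by
    rw [h18]
    repeat' first
      | with_reducible assumption
      | exact (rfl : (_ : ℕ) = _)
      | with_reducible apply add_mem
      | with_reducible apply sub_mem
      | with_reducible apply neg_mem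
      | with_reducible apply mul_mem_degreePart
      | with_reducible apply pow_mem_degreePart
  have h20 : x20 ∈ degreePart 20 :=
    add_mem (mul_mem_degreePart h12 h8 rfl) (mul_mem_degreePart h16 h4 rfl)
  have h22 : y22 ∈ degreePart 22 :=
    sub_mem (mul_mem_degreePart h12 h10 rfl) (mul_mem_degreePart h18 h4 rfl)
  have h26 : y26 ∈ degreePart 26 :=
    add_mem (mul_mem_degreePart h16 h10 rfl) (mul_mem_degreePart h18 h8 rfl)
  have h24 : g24 ∈ degreePart 24 := by
    rw [g24]
    repeat' first
      | with_reducible assumption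
      | exact (rfl : (_ : ℕ) = _)
      | with_reducible apply add_mem
      | with_reducible apply sub_mem
      | with_reducible apply neg_mem
      | with_reducible apply mul_mem_degreePart
      | with_reducible apply pow_mem_degreePart
  refine ⟨h4, h8, h10, h20, h22, h26, ?_⟩
  rw [x36, x48, x54, y58, y60, y64, y76]
  repeat' first
    | with_reducible assumption
    | exact (rfl : (_ : ℕ) = _)
    | with_reducible apply And.intro
    | with_reducible apply add_mem
    | with_reducible apply sub_mem
    | with_reducible apply neg_mem
    | with_reducible apply mul_mem_degreePart
    | with_reducible apply pow_mem_degreePart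

/-- Degrees of the basis symbols of the first summand of `C`. -/
def degγ : Fin 9 → ℕ := ![0, 20, 40, 22, 44, 42, 58, 60, 76]

/-- Degrees of the basis symbols of the second summand of `C`. -/
def degδ : Fin 5 → ℕ := ![26, 52, 46, 48, 64]

/-- The degree of the coefficient monomial times the basis symbol. -/
def degC : (Fin 9 × (Fin 3 →₀ ℕ)) ⊕ (Fin 5 × (Fin 2 →₀ ℕ)) → ℕ :=
  Sum.elim (fun k => degγ k.1 + (k.2 0 * 4 + k.2 1 * 8 + k.2 2 * 10))
    (fun k => degδ k.1 + (k.2 0 * 8 + k.2 1 * 10))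

/-- The degree of `v k`. -/
def degV (k : Idx) : ℕ := degC k.1 + (k.2 0 * 36 + k.2 1 * 48 + k.2 2 * 54)

theorem γ'_mem_degreePart (i : Fin 9) : γ' i ∈ degreePart (degγ i) := by
  obtain ⟨h4, h8, h10, h20, h22, h26, h36, h48, h54, h58, h60, h64, h76⟩ :=
    generators_mem_degreePart
  fin_cases i
  · exact one_mem_degreePart
  · exact h20
  · exact pow_mem_degreePart h20 rfl
  · exact h22
  · exact pow_mem_degreePart h22 rfl
  · exact mul_mem_degreePart h20 h22 rfl
  · exact h58
  · exact h60
  · exact h76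

theorem δ'_mem_degreePart (j : Fin 5) : δ' j ∈ degreePart (degδ j) := by
  obtain ⟨h4, h8, h10, h20, h22, h26, h36, h48, h54, h58, h60, h64, h76⟩ :=
    generators_mem_degreePart
  fin_cases j
  · exact h26
  · exact pow_mem_degreePart h26 rfl
  · exact mul_mem_degreePart h20 h26 rfl
  · exact mul_mem_degreePart h22 h26 rfl
  · exact h64

theorem v_mem_degreePart (k : Idx) : v k ∈ degreePart (degV k) := by
  obtain ⟨h4, h8, h10, -, -, -, h36, h48, h54, -⟩ := generators_mem_degreePart
  obtain ⟨⟨i, e⟩ | ⟨j, e⟩, J⟩ := k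
  · refine mul_mem_degreePart (mul_mem_degreePart (mul_mem_degreePart (mul_mem_degreePart
      (pow_mem_degreePart h4 rfl) (pow_mem_degreePart h8 rfl) rfl) (pow_mem_degreePart h10 rfl) rfl)
      (γ'_mem_degreePart i) rfl) (mul_mem_degreePart (mul_mem_degreePart
      (pow_mem_degreePart h36 rfl) (pow_mem_degreePart h48 rfl) rfl) (pow_mem_degreePart h54 rfl)
      rfl) ?_
    simp only [degV, degC, Sum.elim_inl]
    ring
  · refine mul_mem_degreePart (mul_mem_degreePart (mul_mem_degreePart
      (pow_mem_degreePart h8 rfl) (pow_mem_degreePart h10 rfl) rfl)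
      (δ'_mem_degreePart j) rfl) (mul_mem_degreePart (mul_mem_degreePart
      (pow_mem_degreePart h36 rfl) (pow_mem_degreePart h48 rfl) rfl) (pow_mem_degreePart h54 rfl)
      rfl) ?_
    simp only [degV, degC, Sum.elim_inr]
    ring

theorem component_v (k : Idx) (n : ℕ) :
    MvPolynomial.weightedHomogeneousComponent (fun _ : Fin 6 => 2) n (v k) =
      if degV k = n then v k else 0 := by
  split_ifs with h
  · exact MvPolynomial.IsWeightedHomogeneous.weightedHomogeneousComponent_same
      (h ▸ v_mem_degreePart k)
  · exact MvPolynomial.IsWeightedHomogeneous.weightedHomogeneousComponent_ne _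
      (v_mem_degreePart k) (Ne.symm h)

theorem component_mem_span {f : HBT} (hf : f ∈ N) (n : ℕ) :
    MvPolynomial.weightedHomogeneousComponent (fun _ : Fin 6 => 2) n f ∈
      Submodule.span (ZMod 3) (v '' {k | degV k = n}) := by
  induction hf using Submodule.span_induction with
  | mem x hx =>
    obtain ⟨k, rfl⟩ := hx
    rw [component_v]
    split_ifs with h
    · exact Submodule.subset_span ⟨k, h, rfl⟩
    · exact zero_mem _
  | zero => rw [map_zero]; exact zero_mem _
  | add a b _ _ ha hb => rw [map_add]; exact add_mem ha hb
  | smul r a _ ha => rw [map_smul]; exact Submodule.smul_mem _ r ha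

theorem component_mem_A {f : HBT} (hf : f ∈ A) (n : ℕ) :
    MvPolynomial.weightedHomogeneousComponent (fun _ : Fin 6 => 2) n f ∈ A := by
  rw [← Subalgebra.mem_toSubmodule, toSubmodule_A] at hf ⊢
  exact Submodule.span_mono (Set.image_subset_range _ _) (component_mem_span hf n)

theorem gradedPiece_A (n : ℕ) : gradedPiece (Subalgebra.toSubmodule A) n =
    Submodule.span (ZMod 3) (v '' {k | degV k = n}) := by
  rw [toSubmodule_A]
  apply le_antisymm
  · rintro f ⟨hf, hn⟩
    rw [← MvPolynomial.IsWeightedHomogeneous.weightedHomogeneousComponent_same hn]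
    exact component_mem_span hf n
  · rw [Submodule.span_le]
    rintro _ ⟨k, rfl, rfl⟩
    exact ⟨v_mem_N k, v_mem_degreePart k⟩

theorem finrank_gradedPiece_A (n : ℕ) :
    Module.finrank (ZMod 3) (gradedPiece (Subalgebra.toSubmodule A) n) =
      {k | degV k = n}.ncard := by
  have hi : LinearIndependent (ZMod 3) fun k : {k | degV k = n} => v k :=
    linearIndependent_v.comp _ Subtype.val_injective
  have := Module.finrank_eq_nat_card_basis (Module.Basis.span hi)
  rw [gradedPiece_A, Set.image_eq_range, this, Nat.card_coe_set_eq]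

/-- The power series `F` counts the elements of `ι` by their degree `d`, all fibres being finite. -/
def IsCountingSeries {ι : Type*} (d : ι → ℕ) (F : PowerSeries ℤ) : Prop :=
  ∀ n, {i | d i = n}.Finite ∧ PowerSeries.coeff n F = ({i | d i = n}.ncard : ℤ)

open PowerSeries

theorem IsCountingSeries.sumElim {ι κ : Type*} {d : ι → ℕ} {d' : κ → ℕ} {F G : ℤ⟦X⟧}
    (hF : IsCountingSeries d F) (hG : IsCountingSeries d' G) :
    IsCountingSeries (Sum.elim d d') (F + G) := by
  intro n
  have h : {i | Sum.elim d d' i = n} = Sum.inl '' {i | d i = n} ∪ Sum.inr '' {i | d' i = n} := by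
    ext (i | i) <;> simp
  have h1 := (hF n).1.image (Sum.inl : ι → ι ⊕ κ)
  have h2 := (hG n).1.image (Sum.inr : κ → ι ⊕ κ)
  rw [h]
  refine ⟨h1.union h2, ?_⟩
  rw [Set.ncard_union_eq _ h1 h2, Set.ncard_image_of_injective _ Sum.inl_injective,
    Set.ncard_image_of_injective _ Sum.inr_injective, map_add, (hF n).2, (hG n).2, Nat.cast_add]
  rw [Set.disjoint_left]
  rintro _ ⟨i, -, rfl⟩ ⟨j, -, h⟩
  cases h

theorem IsCountingSeries.prod {ι κ : Type*} {d : ι → ℕ} {d' : κ → ℕ} {F G : ℤ⟦X⟧}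
    (hF : IsCountingSeries d F) (hG : IsCountingSeries d' G) :
    IsCountingSeries (fun k : ι × κ => d k.1 + d' k.2) (F * G) := by
  intro n
  have h : {k : ι × κ | d k.1 + d' k.2 = n} =
      ⋃ a ∈ (Finset.HasAntidiagonal.antidiagonal n : Set (ℕ × ℕ)),
        {i | d i = a.1} ×ˢ {j | d' j = a.2} := by
    ext ⟨i, j⟩
    simp only [Set.mem_ofPred_eq, Set.mem_iUnion, Set.mem_prod, Finset.mem_coe,
      Finset.HasAntidiagonal.mem_antidiagonal]
    exact ⟨fun h => ⟨(d i, d' j), h, rfl, rfl⟩, fun ⟨a, h, h1, h2⟩ => by rw [h1, h2, h]⟩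
  have hfin : ∀ a ∈ (Finset.HasAntidiagonal.antidiagonal n : Set (ℕ × ℕ)),
      ({i | d i = a.1} ×ˢ {j | d' j = a.2}).Finite := fun a _ => (hF a.1).1.prod (hG a.2).1
  have hdisj : (Finset.HasAntidiagonal.antidiagonal n : Set (ℕ × ℕ)).PairwiseDisjoint
      fun a => {i | d i = a.1} ×ˢ {j | d' j = a.2} := by
    intro a _ b _ hab
    refine Set.disjoint_left.2 ?_
    rintro ⟨i, j⟩ ⟨h1, h2⟩ ⟨h3, h4⟩
    exact hab (Prod.ext (h1.symm.trans h3) (h2.symm.trans h4))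
  rw [h]
  refine ⟨(Finset.finite_toSet _).biUnion hfin, ?_⟩
  rw [(Finset.finite_toSet _).ncard_biUnion hfin hdisj, finsum_mem_coe_finset, coeff_mul,
    Nat.cast_sum]
  refine Finset.sum_congr rfl fun a _ => ?_
  rw [Set.ncard_prod, (hF a.1).2, (hG a.2).2, Nat.cast_mul]

theorem IsCountingSeries.equiv {ι κ : Type*} {d : ι → ℕ} {F : ℤ⟦X⟧} (hF : IsCountingSeries d F)
    (e : κ ≃ ι) {d' : κ → ℕ} (h : ∀ k, d' k = d (e k)) : IsCountingSeries d' F := by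
  intro n
  have hs : {k | d' k = n} = e ⁻¹' {i | d i = n} := by ext k; simp [h]
  rw [hs]
  refine ⟨(hF n).1.preimage e.injective.injOn, ?_⟩
  rw [Set.ncard_preimage_of_injective_subset_range e.injective (by simp), (hF n).2]

theorem IsCountingSeries.fintype {ι : Type*} [Fintype ι] (d : ι → ℕ) :
    IsCountingSeries d (∑ i, X ^ d i) := by
  classical
  intro n
  refine ⟨Set.toFinite _, ?_⟩
  simp only [map_sum, coeff_X_pow]
  rw [Finset.sum_boole, Set.ncard_eq_toFinset_card']
  congr 2
  ext i
  simp [eq_comm]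

/-- The series `∑ X ^ (k * m)`. -/
def geom (m : ℕ) : ℤ⟦X⟧ := PowerSeries.mk fun n => if m ∣ n then 1 else 0

theorem geom_mul_one_sub {m : ℕ} (hm : 0 < m) : geom m * (1 - X ^ m) = 1 := by
  ext n
  rw [mul_sub, mul_one, map_sub, coeff_mul_X_pow', coeff_one, geom, coeff_mk, coeff_mk]
  rcases Nat.lt_or_ge n m with h | h
  · rw [if_neg (by omega : ¬ m ≤ n), sub_zero]
    congr 1
    rw [eq_iff_iff]
    exact ⟨fun hd => Nat.eq_zero_of_dvd_of_lt hd h, fun h0 => h0 ▸ dvd_zero m⟩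
  · rw [if_pos h, if_neg (by omega : n ≠ 0), sub_eq_zero]
    congr 1
    rw [eq_iff_iff]
    exact ⟨fun hd => Nat.dvd_sub hd dvd_rfl, fun hd => Nat.sub_add_cancel h ▸ dvd_add hd dvd_rfl⟩

theorem isCountingSeries_geom {m : ℕ} (hm : 0 < m) :
    IsCountingSeries (fun k : ℕ => k * m) (geom m) := by
  intro n
  rw [geom, coeff_mk]
  by_cases h : m ∣ n
  · obtain ⟨k, rfl⟩ := h
    have : {i : ℕ | i * m = m * k} = {k} := by
      ext i
      simp only [Set.mem_ofPred_eq, Set.mem_singleton_iff, mul_comm m k]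
      exact Nat.mul_left_inj hm.ne'
    rw [this]
    simp
  · have : {i : ℕ | i * m = n} = ∅ := by
      ext i
      simp only [Set.mem_ofPred_eq, Set.mem_empty_iff_false, iff_false]
      rintro rfl
      exact h (dvd_mul_left m i)
    rw [this]
    simp [h]

theorem isCountingSeries_fin_two {m n : ℕ} (hm : 0 < m) (hn : 0 < n) :
    IsCountingSeries (fun e : Fin 2 →₀ ℕ => e 0 * m + e 1 * n) (geom m * geom n) :=
  ((isCountingSeries_geom hm).prod (isCountingSeries_geom hn)).equiv
    (Finsupp.equivFunOnFinite.trans (finTwoArrowEquiv ℕ)) fun _ => rfl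

theorem isCountingSeries_fin_three {l m n : ℕ} (hl : 0 < l) (hm : 0 < m) (hn : 0 < n) :
    IsCountingSeries (fun e : Fin 3 →₀ ℕ => e 0 * l + e 1 * m + e 2 * n)
      (geom l * (geom m * geom n)) :=
  ((isCountingSeries_geom hl).prod
    ((isCountingSeries_geom hm).prod (isCountingSeries_geom hn))).equiv
    (Finsupp.equivFunOnFinite.trans ((Fin.consEquiv fun _ => ℕ).symm.trans
      ((Equiv.refl ℕ).prodCongr (finTwoArrowEquiv ℕ)))) fun _ => add_assoc _ _ _

theorem isCountingSeries_degV : IsCountingSeries degV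
    (((∑ i, X ^ degγ i) * (geom 4 * (geom 8 * geom 10)) +
      (∑ j, X ^ degδ j) * (geom 8 * geom 10)) * (geom 36 * (geom 48 * geom 54))) :=
  IsCountingSeries.prod (IsCountingSeries.sumElim
    (IsCountingSeries.prod (IsCountingSeries.fintype degγ)
      (isCountingSeries_fin_three (by norm_num) (by norm_num) (by norm_num)))
    (IsCountingSeries.prod (IsCountingSeries.fintype degδ)
      (isCountingSeries_fin_two (by norm_num) (by norm_num))))
    (isCountingSeries_fin_three (by norm_num) (by norm_num) (by norm_num))

theorem poincareSeries_A : poincareSeries (Subalgebra.toSubmodule A) =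
    ((∑ i, X ^ degγ i) * (geom 4 * (geom 8 * geom 10)) +
      (∑ j, X ^ degδ j) * (geom 8 * geom 10)) * (geom 36 * (geom 48 * geom 54)) := by
  ext n
  rw [poincareSeries, coeff_mk, finrank_gradedPiece_A, (isCountingSeries_degV n).2]

theorem poincareSeries_A_mul : poincareSeries (Subalgebra.toSubmodule A) *
    ((1 - X ^ 4) * (1 - X ^ 8) * (1 - X ^ 10) * (1 - X ^ 36) * (1 - X ^ 48) * (1 - X ^ 54)) =
    1 + X ^ 20 + X ^ 22 + X ^ 26 - X ^ 30 + X ^ 40 + X ^ 42 + X ^ 44 + X ^ 46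
      + X ^ 48 - X ^ 50 - X ^ 56 + X ^ 58 + X ^ 60 + X ^ 64 - X ^ 68 + X ^ 76 := by
  have h4 := geom_mul_one_sub (m := 4) (by norm_num)
  have h8 := geom_mul_one_sub (m := 8) (by norm_num)
  have h10 := geom_mul_one_sub (m := 10) (by norm_num)
  have h36 := geom_mul_one_sub (m := 36) (by norm_num)
  have h48 := geom_mul_one_sub (m := 48) (by norm_num)
  have h54 := geom_mul_one_sub (m := 54) (by norm_num)
  calc _ = ((∑ i, X ^ degγ i) * (geom 4 * (1 - X ^ 4)) + (∑ j, X ^ degδ j) * (1 - X ^ 4)) *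
        (geom 8 * (1 - X ^ 8)) * (geom 10 * (1 - X ^ 10)) * (geom 36 * (1 - X ^ 36)) *
        (geom 48 * (1 - X ^ 48)) * (geom 54 * (1 - X ^ 54)) := by rw [poincareSeries_A]; ring
    _ = _ := by
      rw [h4, h8, h10, h36, h48, h54]
      simp only [Fin.sum_univ_succ, degγ, degδ, Matrix.cons_val_zero, Matrix.cons_val_succ]
      simp
      ring

theorem finite_gradedPiece_A (n : ℕ) :
    Module.Finite (ZMod 3) (gradedPiece (Subalgebra.toSubmodule A) n) := by
  rw [gradedPiece_A]
  exact Module.Finite.span_of_finite _ ((isCountingSeries_degV n).1.image v)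

end

end WeylE6

/-! ### The map `σ` -/

namespace WeylE6

noncomputable section

/-- The monomial basis of `C ⊗ Q`. -/
def basisCQ : Module.Basis Idx (ZMod 3) (C ⊗[ZMod 3] Q) :=
  (((Finsupp.basis fun _ : Fin 9 => MvPolynomial.basisMonomials (Fin 3) (ZMod 3)).reindex
      (Equiv.sigmaEquivProd _ _)).prod
    ((Finsupp.basis fun _ : Fin 5 => MvPolynomial.basisMonomials (Fin 2) (ZMod 3)).reindex
      (Equiv.sigmaEquivProd _ _))).tensorProduct (MvPolynomial.basisMonomials (Fin 3) (ZMod 3))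

theorem coe_σ_basisCQ (k : Idx) : (σ (basisCQ k) : HBT) = v k := by
  have hγ (e : Fin 3 →₀ ℕ) (x : Fin 3 → A) :
      MvPolynomial.aeval x (MvPolynomial.monomial e (1 : ZMod 3)) =
        x 0 ^ e 0 * x 1 ^ e 1 * x 2 ^ e 2 := by
    rw [MvPolynomial.aeval_monomial, map_one, one_mul, Finsupp.prod_fintype _ _ (by simp),
      Fin.prod_univ_three]
  have hδ (e : Fin 2 →₀ ℕ) (x : Fin 2 → A) :
      MvPolynomial.aeval x (MvPolynomial.monomial e (1 : ZMod 3)) = x 0 ^ e 0 * x 1 ^ e 1 := by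
    rw [MvPolynomial.aeval_monomial, map_one, one_mul, Finsupp.prod_fintype _ _ (by simp),
      Fin.prod_univ_two]
  obtain ⟨⟨i, e⟩ | ⟨j, e⟩, J⟩ := k
  · simp [basisCQ, σ, evalC, evalQ, Module.Basis.tensorProduct_apply, hγ, v, vC, coe_γ, a, Gen.val]
  · simp [basisCQ, σ, evalC, evalQ, Module.Basis.tensorProduct_apply, hγ, hδ, v, vC, coe_δ, a,
      Gen.val]

theorem σ_bijective : Function.Bijective σ := by
  have hv : A.val.toLinearMap ∘ (σ ∘ basisCQ) = v := funext coe_σ_basisCQ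
  refine LinearMap.bijective_of_linearIndependent_of_span_eq_top basisCQ.span_eq
    (v := basisCQ) (LinearIndependent.of_comp A.val.toLinearMap ?_) ?_
  · rw [hv]; exact linearIndependent_v
  · apply Submodule.map_injective_of_injective (f := A.val.toLinearMap) Subtype.val_injective
    rw [Submodule.map_span, ← Set.range_comp, hv, Submodule.map_top]
    change N = _
    rw [← toSubmodule_A]
    ext f
    simp

end

end WeylE6

open PowerSeries in
theorem proposition4p7 :
    Function.Bijective WeylE6.σ ∧
    -- `A` is a graded subalgebra, with finite-dimensional homogeneous parts
    (∀ f ∈ WeylE6.A, ∀ n,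
      MvPolynomial.weightedHomogeneousComponent (fun _ : Fin 6 => 2) n f ∈ WeylE6.A) ∧
    (∀ n, Module.Finite (ZMod 3)
      (WeylE6.gradedPiece (Subalgebra.toSubmodule WeylE6.A) n)) ∧
    -- the Poincaré series is `g` divided by the product
    WeylE6.poincareSeries (Subalgebra.toSubmodule WeylE6.A) *
        ((1 - X ^ 4) * (1 - X ^ 8) * (1 - X ^ 10) *
          (1 - X ^ 36) * (1 - X ^ 48) * (1 - X ^ 54)) =
      (1 + X ^ 20 + X ^ 22 + X ^ 26 - X ^ 30 + X ^ 40 + X ^ 42 + X ^ 44 + X ^ 46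
        + X ^ 48 - X ^ 50 - X ^ 56 + X ^ 58 + X ^ 60 + X ^ 64 - X ^ 68 + X ^ 76 :
        PowerSeries ℤ) :=
  ⟨WeylE6.σ_bijective, fun _ hf n => WeylE6.component_mem_A hf n, WeylE6.finite_gradedPiece_A,
    WeylE6.poincareSeries_A_mul⟩
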